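/- Let $d,L\in\mathbb N$, let $\tau:\mathrm{SO}(d)\to\mathrm{GL}(L,\mathbb R)$ be a real representation (a group homomorphism), and let $\mathcal S=\mathcal S(\mathbb R^d,\mathbb R^L)$ be the Schwartz space. For $f\in\mathcal S$, $g\in\mathrm{SO}(d)$, $a\in\mathbb R^d$ put $f_g(x)=\tau(g)f(g^{-1}x)$ and $f_a(x)=f(x-a)$. A *random vector field* is a family $(\phi(f))_{f\in\mathcal S}$ of real random variables on a probability space $(\Omega,\mathcal B,P)$ such that $f\mapsto\phi(f)$ is linear $P$-a.s. and $f_n\to f$ in $\mathcal S$ implies $\phi(f_n)\to\phi(f)$ in law. It is a *$\tau$-covariant noise field* if, moreover, $\phi(f_g)$ and $\phi(f_a)$ have the same law as $\phi(f)$ for all $f\in\mathcal S$, $g\in \mathrm{SO}(d)$, $a\in\mathbb R^d$, and $\phi(f)$, $\phi(h)$ are independent whenever $\operatorname{supp}f\cap\operatorname{supp}h=\emptyset$. It is *Gaussian* if all finite families $(\phi(f_1),\dots,\phi(f_n))$ are jointly Gaussian (possibly degenerate). A *characteristic functional* is a map $\mathcal C:\mathcal S\to\mathbb C$ that is continuous,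 positive definite, and satisfies $\mathcal C(0)=1$. A random vector field $\phi$ is *associated* with $\mathcal C$ if $\mathcal C(f)=E[e^{i\phi(f)}]$ for all $f\in\mathcal S$. Let $\psi:\mathbb R^L\to\mathbb C$ be a $C^\infty$ Lévy characteristic, i.e. $$\psi(t)=i\,a\cdot t-\tfrac12\,\sigma t\cdot\sigma t+\int_{\mathbb R^L\setminus\{0\}}\bigl[e^{it\cdot s}-1\bigr]\,dM(s),\qquad t\in\mathbb R^L,$$ with $a\in\mathbb R^L$, $\sigma$ a symmetric positive semidefinite real $L\times L$ matrix, and $M$ a measure on $\mathbb R^L\setminus\{0\}$ (possibly of infinite total mass) with $\int|s|^n\,dM(s)<\infty$ for all integers $n\ge1$. Assume that $\psi$ is $\tau$-invariant: $\psi(\tau(g)t)=\psi(t)$ for all $g\in\mathrm{SO}(d)$, $t\in\mathbb R^L$. (i) For every $f\in\mathcal S$ the function $\psi\circ f$ is integrable over $\mathbb R^d$, and $$\mathcal C_F(f)=\exp\Bigl[\int_{\mathbb R^d}\psi(f(x))\,dx\Bigr],\qquad f\in\mathcal S,$$ is a characteristic functional. There is a random vector field $F$ associated with $\mathcal C_F$,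 and every such $F$ is a $\tau$-covariant noise field. (ii) There is exactly one symmetric positive semidefinite real $L\times L$ matrix $\bar\sigma$ with $\bar\sigma^2=-\bigl(\partial^2\psi/\partial t_\alpha\partial t_\beta(0)\bigr)_{\alpha,\beta=1,\dots,L}$. Let $\Delta$ be the Laplacian on $\mathbb R^d$ (acting componentwise on $\mathcal S$) and let $p$ be a real polynomial with $p(t)\ge0$ for all $t\ge0$. Then for every $f\in\mathcal S$ the function $\bar\sigma f\cdot\bar\sigma p(-\Delta)f$ is integrable over $\mathbb R^d$, and $$\mathcal C_{F^g}(f)=\exp\Bigl[-\int_{\mathbb R^d}\bar\sigma f\cdot\bar\sigma\,p(-\Delta)f\,dx\Bigr],\qquad f\in\mathcal S,$$ is a characteristic functional. There is a random vector field $F^g$ associated with $\mathcal C_{F^g}$, and every such $F^g$ is a Gaussian $\tau$-covariant noise field. -/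

import Mathlib

namespace NoiseField

open MeasureTheory ProbabilityTheory Filter

/-- `ℝⁿ` with its Euclidean structure. -/
abbrev Vec (n : ℕ) : Type := EuclideanSpace ℝ (Fin n)

/-- The Schwartz space `𝒮(ℝᵈ, ℝᴸ)`, with its Fréchet topology. -/
abbrev TestFn (d L : ℕ) : Type := SchwartzMap (Vec d) (Vec L)

/-- The group `SO(d)`. -/
abbrev SO (d : ℕ) : Type := Matrix.specialOrthogonalGroup (Fin d) ℝ

/-- Multiplication of a vector of `ℝⁿ` by a matrix, as a continuous linear map. -/
noncomputable abbrev matAct {n : ℕ} (A : Matrix (Fin n) (Fin n) ℝ) : Vec n →L[ℝ] Vec n :=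
  Matrix.toEuclideanCLM (n := Fin n) (𝕜 := ℝ) A

/-- The standard action of `SO(d)` on `ℝᵈ`, by invertible continuous linear maps. -/
noncomputable def rotation {d : ℕ} (g : SO d) : Vec d ≃L[ℝ] Vec d :=
  ContinuousLinearEquiv.equivOfInverse (matAct (g : Matrix (Fin d) (Fin d) ℝ))
    (matAct ((g⁻¹ : SO d) : Matrix (Fin d) (Fin d) ℝ))
    (fun x => by
      rw [← mul_apply_eq_comp, ← map_mul, ← Submonoid.coe_mul, inv_mul_cancel]
      simp)
    (fun x => by
      rw [← mul_apply_eq_comp, ← map_mul, ← Submonoid.coe_mul, mul_inv_cancel]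
      simp)

/-- `f_g(x) = τ(g) f(g⁻¹ x)`. -/
noncomputable def rotate {d L : ℕ} (τ : SO d →* GL (Fin L) ℝ) (g : SO d) (f : TestFn d L) :
    TestFn d L :=
  SchwartzMap.postcompCLM (𝕜 := ℝ) (matAct (τ g : Matrix (Fin L) (Fin L) ℝ))
    (SchwartzMap.compCLMOfContinuousLinearEquiv ℝ (rotation g⁻¹) f)

theorem rotate_apply {d L : ℕ} (τ : SO d →* GL (Fin L) ℝ) (g : SO d) (f : TestFn d L)
    (x : Vec d) :
    rotate τ g f x = matAct (τ g : Matrix (Fin L) (Fin L) ℝ)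
      (f (matAct ((g⁻¹ : SO d) : Matrix (Fin d) (Fin d) ℝ) x)) := rfl

/-- `f_a(x) = f(x - a)`. -/
noncomputable def translate {d L : ℕ} (a : Vec d) (f : TestFn d L) : TestFn d L :=
  SchwartzMap.compSubConstCLM ℝ a f

theorem translate_apply {d L : ℕ} (a : Vec d) (f : TestFn d L) (x : Vec d) :
    translate a f x = f (x - a) := by
  simp [translate]

/-- A tempered random vector field of dimension `L` over `ℝᵈ`: a family of real random variables
indexed by test functions, almost surely linear, and sequentially continuous in law. -/
structure IsRandomVectorField {d L : ℕ} {Ω : Type*} [MeasurableSpace Ω]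
    (φ : TestFn d L → Ω → ℝ) (P : Measure Ω) [IsProbabilityMeasure P] : Prop where
  measurable : ∀ f, Measurable (φ f)
  ae_linear : ∀ᵐ ω ∂P, IsLinearMap ℝ (fun f => φ f ω)
  tendsto_law : ∀ (u : ℕ → TestFn d L) (f : TestFn d L), Tendsto u atTop (nhds f) →
    TendstoInDistribution (fun n => φ (u n)) atTop (φ f) (fun _ => P) P

/-- A `τ`-covariant noise field: a random vector field that transforms covariantly under `τ`, is
stationary, and is independent on test functions with disjoint (closed) supports. -/
structure IsNoiseField {d L : ℕ} (τ : SO d →* GL (Fin L) ℝ) {Ω : Type*} [MeasurableSpace Ω]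
    (φ : TestFn d L → Ω → ℝ) (P : Measure Ω) [IsProbabilityMeasure P] : Prop
    extends IsRandomVectorField φ P where
  covariant : ∀ (g : SO d) (f : TestFn d L), IdentDistrib (φ f) (φ (rotate τ g f)) P P
  stationary : ∀ (a : Vec d) (f : TestFn d L), IdentDistrib (φ (translate a f)) (φ f) P P
  indep : ∀ f h : TestFn d L, Disjoint (tsupport f) (tsupport h) → IndepFun (φ f) (φ h) P

/-- A characteristic functional on `𝒮(ℝᵈ, ℝᴸ)`: continuous, positive definite, normalized. -/
structure IsCharFunctional {d L : ℕ} (C : TestFn d L → ℂ) : Prop where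
  continuous : Continuous C
  posDef : ∀ (n : ℕ) (f : Fin n → TestFn d L) (z : Fin n → ℂ),
    0 ≤ (∑ j, ∑ k, z j * star (z k) * C (f j - f k)).re ∧
      (∑ j, ∑ k, z j * star (z k) * C (f j - f k)).im = 0
  map_zero : C 0 = 1

/-- `C(f) = E[exp(i φ(f))]` for all test functions `f`. -/
def HasCharFunctional {d L : ℕ} {Ω : Type*} [MeasurableSpace Ω]
    (φ : TestFn d L → Ω → ℝ) (P : Measure Ω) (C : TestFn d L → ℂ) : Prop :=
  ∀ f, C f = ∫ ω, Complex.exp (Complex.I * (φ f ω : ℂ)) ∂P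

/-- A smooth Lévy characteristic over `ℝᴸ`:
`ψ(t) = i a·t - (σt·σt)/2 + ∫_{s ≠ 0} (exp(i t·s) - 1) dM(s)` with `σ` symmetric positive
semidefinite and `M` a measure on `ℝᴸ ∖ {0}` (a measure on `ℝᴸ` without mass at `0`) that has
finite absolute moments of all orders `n ≥ 1`; its total mass may be infinite. -/
def IsSmoothLevyCharacteristic {L : ℕ} (ψ : Vec L → ℂ) : Prop :=
  ∃ (a : Vec L) (σ : Matrix (Fin L) (Fin L) ℝ) (M : Measure (Vec L)),
    σ.PosSemidef ∧ M {0} = 0 ∧ (∀ n : ℕ, 1 ≤ n → Integrable (fun s => ‖s‖ ^ n) M) ∧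
    ∀ t, ψ t = Complex.I * ((inner ℝ a t : ℝ) : ℂ)
      - ((inner ℝ (matAct σ t) (matAct σ t) : ℝ) : ℂ) / 2
      + ∫ s, (Complex.exp (Complex.I * ((inner ℝ t s : ℝ) : ℂ)) - 1) ∂M

/-- `ψ(τ(g) t) = ψ(t)` for all `g` and `t`. -/
def IsInvariant {d L : ℕ} (τ : SO d →* GL (Fin L) ℝ) (ψ : Vec L → ℂ) : Prop :=
  ∀ (g : SO d) (t : Vec L), ψ (matAct (τ g : Matrix (Fin L) (Fin L) ℝ) t) = ψ t

/-- The functional `f ↦ exp(∫ ψ(f(x)) dx)`. -/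
noncomputable def levyFunctional {d L : ℕ} (ψ : Vec L → ℂ) (f : TestFn d L) : ℂ :=
  Complex.exp (∫ x, ψ (f x))

/-- The matrix of second partial derivatives of `ψ` at the origin. -/
noncomputable def hessianAtZero {L : ℕ} (ψ : Vec L → ℂ) : Matrix (Fin L) (Fin L) ℂ :=
  Matrix.of fun α β =>
    lineDeriv ℝ (fun t => lineDeriv ℝ ψ t (EuclideanSpace.single β 1)) 0
      (EuclideanSpace.single α 1)

/-- `S` is a positive semidefinite real symmetric matrix with `S² = -(∂²ψ/∂t_α∂t_β (0))_{α,β}`. -/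
def IsSigmaBar {L : ℕ} (ψ : Vec L → ℂ) (S : Matrix (Fin L) (Fin L) ℝ) : Prop :=
  S.PosSemidef ∧ (S * S).map (fun r => (r : ℂ)) = -hessianAtZero ψ

/-- The operator `p(-Δ)` on `𝒮(ℝᵈ, ℝᴸ)`, the Laplacian acting componentwise. -/
noncomputable def polyNegLaplacian (d L : ℕ) (p : Polynomial ℝ) : TestFn d L →L[ℝ] TestFn d L :=
  Polynomial.aeval (-(LineDeriv.laplacianCLM ℝ (Vec d) (TestFn d L) :
    TestFn d L →L[ℝ] TestFn d L)) p

/-- The integrand `S f(x) · S (p(-Δ)f)(x)`. -/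
noncomputable def gaussIntegrand {d L : ℕ} (S : Matrix (Fin L) (Fin L) ℝ) (p : Polynomial ℝ)
    (f : TestFn d L) (x : Vec d) : ℝ :=
  inner ℝ (matAct S (f x)) (matAct S (polyNegLaplacian d L p f x))

/-- The functional `f ↦ exp(-∫ S f · S p(-Δ)f dx)`. -/
noncomputable def gaussFunctional {d L : ℕ} (S : Matrix (Fin L) (Fin L) ℝ) (p : Polynomial ℝ)
    (f : TestFn d L) : ℂ :=
  Complex.exp (-((∫ x, gaussIntegrand S p f x : ℝ) : ℂ))

end NoiseField

/-!
Both functionals have the form `exp ∘ B`, and both halves of the theorem rest on three facts about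
such functionals.

*Positive definiteness* is Schoenberg's criterion (`isPosDefFun_exp`): `exp ∘ B` is positive
definite when `B (f - h)` is, up to terms in `f` alone and in `h` alone, a positive semidefinite
kernel, since entrywise exponentials preserve positive semidefiniteness by the Schur product
theorem. For the Lévy functional the kernel is the integral over `x` of
`σ f(x) · σ h(x) + ∫ (exp(i f(x)·s) - 1) conj(exp(i h(x)·s) - 1) dM(s)`. For the Gaussian functional
it is twice the form `∫ S f · S p(-Δ)h dx`, which on the Fourier side is
`∫ p((2π|ξ|)²) ⟪𝓕(S f), 𝓕(S h)⟫ dξ` by Plancherel's theorem, hence Hermitian and positive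
semidefinite (`star_gaussForm`, `sum_gaussForm_nonneg`).

*Existence of the field* (`IsCharFunctional.exists_randomVectorField`) holds for every
characteristic functional `C`. Bochner's theorem in finite dimension
(`IsPosDefFun.exists_charFun_eq`) turns `C`, restricted to finite-dimensional subspaces, into a
projective family of laws; Kolmogorov's extension theorem (`exists_isProjectiveLimit`) realizes the
values on a Hamel basis of the Schwartz space, and linear extension gives a field that is linear
everywhere, not just almost surely. Continuity in law is Lévy's continuity theorem.

*The properties of every associated field* are read off from `C`, because the law of `φ f` and the
joint law of `(φ f, φ h)` have characteristic functions `C (t • f)` and `C (s • f + t • h)`.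
Covariance and stationarity become invariance of `C`, and independence becomes multiplicativity
(`IsRandomVectorField.isNoiseField`). The integrands are local, because `ψ 0 = 0` and differential
operators do not enlarge supports. The Gaussian functional is rotation invariant because the
Laplacian is, and because `⟪S v, S w⟫`, being minus the second derivative of `ψ` at the origin,
inherits the `τ`-invariance of `ψ` (`IsSmoothLevyCharacteristic.inner_matAct_sigmaBar`).
The matrix `S` is the unique positive semidefinite square root of the covariance
`σ² + ∫ s sᵀ dM(s)` (`IsSmoothLevyCharacteristic.existsUnique_sigmaBar`).
-/

namespace NoiseField

open MeasureTheory ProbabilityTheory Filter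
open scoped Topology ENNReal Matrix ComplexOrder

/-! ### Positive definite functions on additive groups -/

/-- Positive definiteness of a complex function on an additive group. That the double sum is real
and nonnegative is written as two conditions, so that `IsCharFunctional.posDef` is the special case
of the Schwartz space. -/
def IsPosDefFun {V : Type*} [AddGroup V] (C : V → ℂ) : Prop :=
  ∀ (n : ℕ) (f : Fin n → V) (z : Fin n → ℂ),
    0 ≤ (∑ j, ∑ k, z j * star (z k) * C (f j - f k)).re ∧
      (∑ j, ∑ k, z j * star (z k) * C (f j - f k)).im = 0

/-- Test the definition on the points `0`, `v` with weights `1`, `z`. The choices `z = 1` and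
`z = i` give `C (-v) = conj (C v)`, and `z = -conj (C v)` then gives the bound. -/
theorem IsPosDefFun.norm_le_one {V : Type*} [AddGroup V] {C : V → ℂ} (hC : IsPosDefFun C)
    (h0 : C 0 = 1) (v : V) : ‖C v‖ ≤ 1 := by
  have key : ∀ z : ℂ, 0 ≤ (1 + z * star z + star z * C (-v) + z * C v).re ∧
      (1 + z * star z + star z * C (-v) + z * C v).im = 0 := by
    intro z
    have h := hC 2 ![0, v] ![1, z]
    have e : (∑ j, ∑ k, ![1, z] j * star (![1, z] k) * C (![0, v] j - ![0, v] k)) =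
        1 + z * star z + star z * C (-v) + z * C v := by
      simp [Fin.sum_univ_two, h0]; ring
    rwa [e] at h
  have h1 := (key 1).2
  have h2 := (key Complex.I).2
  have h3 := (key (-star (C v))).1
  simp at h1 h2 h3
  have : ‖C v‖ ^ 2 ≤ 1 := by
    rw [← Complex.normSq_eq_norm_sq, Complex.normSq_apply]
    rw [show (C (-v)).re = (C v).re by linarith, show (C (-v)).im = -(C v).im by linarith] at h3
    linarith
  nlinarith [norm_nonneg (C v)]

/-- Multiplication by the character `v ↦ exp (-i ℓ v)` preserves positive definiteness. -/
theorem IsPosDefFun.mul_char {V : Type*} [AddCommGroup V] {C : V → ℂ} (hC : IsPosDefFun C)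
    (ℓ : V →+ ℝ) : IsPosDefFun (fun v => C v * Complex.exp (-(ℓ v : ℂ) * Complex.I)) := by
  intro n f z
  have h := hC n f (fun j => z j * Complex.exp (-(ℓ (f j) : ℂ) * Complex.I))
  have e : ∀ j k, z j * Complex.exp (-(ℓ (f j) : ℂ) * Complex.I) *
      star (z k * Complex.exp (-(ℓ (f k) : ℂ) * Complex.I)) * C (f j - f k) =
      z j * star (z k) * (C (f j - f k) *
        Complex.exp (-(ℓ (f j - f k) : ℂ) * Complex.I)) := by
    intro j k
    have : star (Complex.exp (-(ℓ (f k) : ℂ) * Complex.I)) =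
        Complex.exp ((ℓ (f k) : ℂ) * Complex.I) := by
      rw [Complex.star_def, ← Complex.exp_conj]; simp
    rw [star_mul', this, map_sub, Complex.ofReal_sub,
      show -((ℓ (f j) : ℂ) - ℓ (f k)) * Complex.I =
        -(ℓ (f j) : ℂ) * Complex.I + (ℓ (f k) : ℂ) * Complex.I by ring, Complex.exp_add]
    ring
  simp only [e] at h
  exact h

/-- A positive definite function has nonnegative double averages: average the defining inequality
over `n` independent points and let `n → ∞`. -/
theorem IsPosDefFun.integral_integral_nonneg {V : Type*} [AddCommGroup V] [MeasurableSpace V]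
    [MeasurableSub₂ V] {C : V → ℂ} (hC : IsPosDefFun C) (hm : Measurable C)
    (hb : ∃ K, ∀ v, ‖C v‖ ≤ K) (μ : Measure V) [IsProbabilityMeasure μ] :
    0 ≤ (∫ p, C (p.1 - p.2) ∂(μ.prod μ)).re ∧ (∫ p, C (p.1 - p.2) ∂(μ.prod μ)).im = 0 := by
  obtain ⟨K, hK⟩ := hb
  set J := ∫ p, C (p.1 - p.2) ∂(μ.prod μ) with hJ
  have hms : ∀ (n : ℕ) (j k : Fin n), AEStronglyMeasurable (fun s : Fin n → V => C (s j - s k))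
      (Measure.pi fun _ : Fin n => μ) := fun n j k =>
    (hm.comp ((measurable_pi_apply j).sub (measurable_pi_apply k))).aestronglyMeasurable
  have hpair : ∀ (n : ℕ) (j k : Fin n), j ≠ k →
      ∫ s, C (s j - s k) ∂(Measure.pi fun _ : Fin n => μ) = J := by
    intro n j k hjk
    have hind : iIndepFun (fun (i : Fin n) (s : Fin n → V) => s i)
        (Measure.pi fun _ : Fin n => μ) :=
      iIndepFun_pi (X := fun _ => id) (fun _ => aemeasurable_id)
    have h2 := hind.indepFun hjk
    rw [indepFun_iff_map_prod_eq_prod_map_map (measurable_pi_apply j).aemeasurable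
      (measurable_pi_apply k).aemeasurable] at h2
    have e : ∀ i : Fin n, (Measure.pi fun _ : Fin n => μ).map (fun s => s i) = μ := fun i =>
      (measurePreserving_eval (fun _ : Fin n => μ) i).map_eq
    rw [e, e] at h2
    rw [hJ, ← h2, integral_map
      ((measurable_pi_apply j).prodMk (measurable_pi_apply k)).aemeasurable
      (hm.comp measurable_sub).aestronglyMeasurable]
  have hsum : ∀ n : ℕ, ∫ s, ∑ j : Fin n, ∑ k : Fin n, C (s j - s k)
      ∂(Measure.pi fun _ : Fin n => μ) = n * C 0 + n * (n - 1) * J := by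
    intro n
    have hint : ∀ j k : Fin n, Integrable (fun s : Fin n → V => C (s j - s k))
        (Measure.pi fun _ : Fin n => μ) := fun j k =>
      Integrable.of_bound (hms _ j k) K (Eventually.of_forall fun s => hK _)
    rw [integral_finsetSum _ (fun j _ => integrable_finsetSum _ fun k _ => hint j k)]
    have : ∀ j : Fin n, ∫ s, ∑ k : Fin n, C (s j - s k) ∂(Measure.pi fun _ : Fin n => μ)
        = C 0 + (n - 1) * J := by
      intro j
      rw [integral_finsetSum _ (fun k _ => hint j k),
        ← Finset.add_sum_erase _ _ (Finset.mem_univ j),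
        Finset.sum_congr rfl (fun k hk => hpair n j k (Finset.ne_of_mem_erase hk).symm)]
      have : 1 ≤ n := by have := j.2; omega
      simp [this]
    simp only [this]
    simp
    ring
  have hpos : ∀ n : ℕ, 0 ≤ (n * C 0 + n * (n - 1) * J).re ∧ (n * C 0 + n * (n - 1) * J).im = 0 := by
    intro n
    have hint : Integrable (fun s : Fin n → V => ∑ j : Fin n, ∑ k : Fin n, C (s j - s k))
        (Measure.pi fun _ : Fin n => μ) :=
      integrable_finsetSum _ fun j _ => integrable_finsetSum _ fun k _ =>
        Integrable.of_bound (hms _ j k) K (Eventually.of_forall fun s => hK _)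
    rw [← hsum n]
    have h := fun s : Fin n → V => hC n s (fun _ => 1)
    simp only [star_one, mul_one, one_mul] at h
    constructor
    · have := integral_re hint
      simp only [RCLike.re_eq_complex_re] at this
      rw [← this]
      exact integral_nonneg fun s => (h s).1
    · have := integral_im hint
      simp only [RCLike.im_eq_complex_im] at this
      rw [← this]
      simp [(h _).2]
  have hc : ∀ n : ℕ, ((n : ℂ) * C 0 + n * (n - 1) * J) =
      ((n : ℝ) : ℂ) * C 0 + ((n * (n - 1) : ℝ) : ℂ) * J := by intro n; push_cast; ring
  simp only [hc, Complex.add_re, Complex.add_im, Complex.re_ofReal_mul, Complex.im_ofReal_mul]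
    at hpos
  -- `n C(0) + n (n - 1) J ≥ 0` for all `n` forces `J ≥ 0`, as the quadratic term dominates
  constructor
  · by_contra hneg
    push Not at hneg
    obtain ⟨n, hn⟩ := exists_nat_gt ((C 0).re / (-J.re))
    have h := (hpos (n + 1)).1
    rw [div_lt_iff₀ (by linarith)] at hn
    push_cast at h
    have h1 : (0 : ℝ) < n + 1 := by positivity
    nlinarith
  · have h1 := (hpos 1).2
    have h2 := (hpos 2).2
    norm_num at h1 h2
    linarith

/-! ### Bochner's theorem in finite dimension -/

section Bochner

open scoped FourierTransform RealInnerProductSpace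

variable {E : Type*} [NormedAddCommGroup E] [InnerProductSpace ℝ E] [FiniteDimensional ℝ E]
  [MeasurableSpace E] [BorelSpace E]

theorem integrable_exp_neg_mul_norm_sq {b : ℝ} (hb : 0 < b) :
    Integrable (fun v : E => Real.exp (-b * ‖v‖ ^ 2)) := by
  have h := GaussianFourier.integrable_cexp_neg_mul_sq_norm_add (V := E) (b := (b : ℂ))
    (by simpa using hb) 0 0
  refine h.norm.congr (Eventually.of_forall fun v => ?_)
  have e : (-(b : ℂ) * (‖v‖ : ℂ) ^ 2 + 0 * ((inner ℝ (0 : E) v : ℝ) : ℂ)) =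
      ((-b * ‖v‖ ^ 2 : ℝ) : ℂ) := by push_cast; ring
  simp only [e, Complex.norm_exp, Complex.ofReal_re]

/-- The autocorrelation of a Gaussian density is a Gaussian density. -/
theorem integral_gaussian_mul_gaussian_add (b : ℝ) (u : E) :
    ∫ t : E, Real.exp (-(2 * b) * ‖t‖ ^ 2) * Real.exp (-(2 * b) * ‖u + t‖ ^ 2) =
      Real.exp (-b * ‖u‖ ^ 2) * ∫ t : E, Real.exp (-(4 * b) * ‖t‖ ^ 2) := by
  -- completing the square centres the product of the two densities at `-u/2`
  rw [← integral_const_mul,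
    ← integral_add_right_eq_self (fun t : E =>
      Real.exp (-b * ‖u‖ ^ 2) * Real.exp (-(4 * b) * ‖t‖ ^ 2)) ((2⁻¹ : ℝ) • u)]
  congr 1 with t
  rw [← Real.exp_add, ← Real.exp_add]
  congr 1
  rw [norm_add_sq_real, norm_add_sq_real, norm_smul, inner_smul_right, real_inner_comm,
    Real.norm_of_nonneg (by norm_num)]
  ring

/-- Integrability over the product, for Fubini's theorem: the exponent is dominated by that of a
product Gaussian because `‖u‖² ≤ 2 ‖u + t‖² + 2 ‖t‖²`. -/
theorem integrable_prod_gaussian {b : ℝ} (hb : 0 < b) {F : E → ℂ} (hF : Continuous F)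
    (hF1 : ∀ v, ‖F v‖ ≤ 1) :
    Integrable (fun p : E × E => (Real.exp (-(2 * b) * ‖p.1‖ ^ 2) *
      Real.exp (-(2 * b) * ‖p.2 + p.1‖ ^ 2) : ℝ) • F p.2) (volume.prod volume) := by
  have hg : Integrable (fun v : E => Real.exp (-(b / 3) * ‖v‖ ^ 2)) :=
    integrable_exp_neg_mul_norm_sq (by positivity)
  refine (hg.mul_prod hg).mono' (Continuous.aestronglyMeasurable (by fun_prop))
    (Eventually.of_forall fun p => ?_)
  rw [norm_smul, Real.norm_of_nonneg (by positivity)]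
  refine (mul_le_of_le_one_right (by positivity) (hF1 _)).trans ?_
  rw [← Real.exp_add, ← Real.exp_add, Real.exp_le_exp]
  have h1 : ‖p.2‖ ^ 2 ≤ 2 * ‖p.2 + p.1‖ ^ 2 + 2 * ‖p.1‖ ^ 2 := by
    have : ‖p.2‖ ≤ ‖p.2 + p.1‖ + ‖p.1‖ := by
      simpa using norm_sub_le (p.2 + p.1) p.1
    nlinarith [norm_nonneg p.2, sq_nonneg (‖p.2 + p.1‖ - ‖p.1‖)]
  nlinarith [sq_nonneg ‖p.2 + p.1‖, sq_nonneg ‖p.1‖]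

/-- A continuous positive definite function has nonnegative integral against a centred isotropic
Gaussian density: that integral is a double average over two independent Gaussian points. -/
theorem IsPosDefFun.integral_gaussian_nonneg {F : E → ℂ} (hF : IsPosDefFun F) (hc : Continuous F)
    (hF1 : ∀ v, ‖F v‖ ≤ 1) {b : ℝ} (hb : 0 < b) :
    0 ≤ (∫ u, Real.exp (-b * ‖u‖ ^ 2) • F u).re ∧
      (∫ u, Real.exp (-b * ‖u‖ ^ 2) • F u).im = 0 := by
  have hint : Integrable (fun s : E => Real.exp (-(2 * b) * ‖s‖ ^ 2)) :=
    integrable_exp_neg_mul_norm_sq (by positivity)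
  have hint4 : Integrable (fun s : E => Real.exp (-(4 * b) * ‖s‖ ^ 2)) :=
    integrable_exp_neg_mul_norm_sq (by positivity)
  set μ : Measure E := (volume : Measure E).tilted (fun s => -(2 * b) * ‖s‖ ^ 2) with hμ
  have : IsProbabilityMeasure μ := isProbabilityMeasure_tilted hint
  set m : ℝ := ∫ s : E, Real.exp (-(2 * b) * ‖s‖ ^ 2)
  set κ : ℝ := ∫ t : E, Real.exp (-(4 * b) * ‖t‖ ^ 2)
  have hm : 0 < m := integral_exp_pos hint
  have hκ : 0 < κ := integral_exp_pos hint4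
  have key : ∫ p, F (p.1 - p.2) ∂(μ.prod μ) =
      (κ / m ^ 2 : ℝ) • ∫ u, Real.exp (-b * ‖u‖ ^ 2) • F u := by
    have hi : Integrable (fun p : E × E => F (p.1 - p.2)) (μ.prod μ) :=
      Integrable.of_bound (Continuous.aestronglyMeasurable (by fun_prop)) 1
        (Eventually.of_forall fun p => hF1 _)
    have hμi : ∀ G : E → ℂ, ∫ x, G x ∂μ = ∫ x, (Real.exp (-(2 * b) * ‖x‖ ^ 2) / m) • G x :=
      fun G => integral_tilted _ G
    rw [integral_prod_symm _ hi]
    simp only [hμi]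
    have e1 : ∀ t : E, ∫ s : E, (Real.exp (-(2 * b) * ‖s‖ ^ 2) / m) • F (s - t) =
        ∫ u : E, (Real.exp (-(2 * b) * ‖u + t‖ ^ 2) / m) • F u := by
      intro t
      rw [← integral_add_right_eq_self _ t]
      simp
    simp only [e1]
    have e2 : ∀ t : E, (Real.exp (-(2 * b) * ‖t‖ ^ 2) / m) •
        ∫ u : E, (Real.exp (-(2 * b) * ‖u + t‖ ^ 2) / m) • F u =
        (1 / m ^ 2 : ℝ) • ∫ u : E, (Real.exp (-(2 * b) * ‖t‖ ^ 2) *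
          Real.exp (-(2 * b) * ‖u + t‖ ^ 2) : ℝ) • F u := by
      intro t
      rw [← integral_smul, ← integral_smul]
      congr 1 with u
      rw [smul_smul, smul_smul]
      congr 1
      field_simp
    simp only [e2]
    rw [integral_smul, integral_integral_swap (integrable_prod_gaussian hb hc hF1)]
    have e3 : ∀ u : E, ∫ t : E, (Real.exp (-(2 * b) * ‖t‖ ^ 2) *
        Real.exp (-(2 * b) * ‖u + t‖ ^ 2) : ℝ) • F u =
        κ • (Real.exp (-b * ‖u‖ ^ 2) • F u) := by
      intro u
      rw [integral_smul_const, integral_gaussian_mul_gaussian_add, smul_smul, mul_comm]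
    simp only [e3]
    rw [integral_smul, smul_smul]
    congr 1
    ring
  have h := hF.integral_integral_nonneg hc.measurable ⟨1, hF1⟩ μ
  rw [key, Complex.smul_re, Complex.smul_im, smul_eq_mul, smul_eq_mul] at h
  have hpos : 0 < κ / m ^ 2 := by positivity
  exact ⟨nonneg_of_mul_nonneg_right h.1 hpos, (mul_eq_zero.mp h.2).resolve_left hpos.ne'⟩

/-- The Fourier transform of a positive definite function damped by a Gaussian is nonnegative: its
value at `w` is the Gaussian integral of the function multiplied by a character, which is again
positive definite. -/
theorem IsPosDefFun.fourier_gaussian_nonneg {C : E → ℂ} (hC : IsPosDefFun C) (hc : Continuous C)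
    (h0 : C 0 = 1) {b : ℝ} (hb : 0 < b) (w : E) :
    0 ≤ (𝓕 (fun u => Real.exp (-b * ‖u‖ ^ 2) • C u) w).re ∧
      (𝓕 (fun u => Real.exp (-b * ‖u‖ ^ 2) • C u) w).im = 0 := by
  have hF := hC.mul_char (((2 * Real.pi) • innerₗ E w).toAddMonoidHom)
  have h := hF.integral_gaussian_nonneg (by simp; fun_prop) (fun v => by
    rw [norm_mul, Complex.norm_exp]
    simpa using hC.norm_le_one h0 v) hb
  have e : 𝓕 (fun u => Real.exp (-b * ‖u‖ ^ 2) • C u) w = ∫ u, Real.exp (-b * ‖u‖ ^ 2) •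
      (C u * Complex.exp
        (-((((2 * Real.pi) • innerₗ E w).toAddMonoidHom u : ℝ) : ℂ) * Complex.I)) := by
    rw [Real.fourier_eq']
    congr 1 with u
    simp only [smul_eq_mul, Complex.real_smul, LinearMap.toAddMonoidHom_coe, LinearMap.smul_apply,
      innerₗ_apply_apply, real_inner_comm w u]
    push_cast
    ring_nf
  rw [e]
  exact h

/-- A continuous integrable function with nonnegative Fourier transform has an integrable Fourier
transform, by Gaussian summation at the origin and Fatou's lemma. -/
theorem integrable_fourier_of_nonneg {f : E → ℂ} (hf : Integrable f) (hc : Continuous f)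
    (hpos : ∀ w, 0 ≤ (𝓕 f w).re ∧ (𝓕 f w).im = 0) : Integrable (𝓕 f) := by
  have hFc : Continuous (𝓕 f) :=
    VectorFourier.fourierIntegral_continuous Real.continuous_fourierChar
      (L := innerₗ E) continuous_inner hf
  have B : Tendsto (fun c : ℝ => ∫ w : E, Complex.exp (-(c : ℂ)⁻¹ * (‖w‖ : ℂ) ^ 2) • 𝓕 f w) atTop
      (𝓝 (f 0)) := by
    refine (Real.tendsto_integral_gaussian_smul' hf (v := (0 : E)) hc.continuousAt).congr' ?_
    filter_upwards [Ioi_mem_atTop 0] with c (hc : 0 < c)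
    have J : Integrable (fun w : E =>
        Complex.exp (-(c : ℂ)⁻¹ * (‖w‖ : ℂ) ^ 2 + 2 * Real.pi * Complex.I *
          ((inner ℝ (0 : E) w : ℝ) : ℂ))) :=
      GaussianFourier.integrable_cexp_neg_mul_sq_norm_add (by simpa) _ _
    have h1 : ∫ w : E, Complex.exp (-(c : ℂ)⁻¹ * (‖w‖ : ℂ) ^ 2) • 𝓕 f w =
        ∫ w : E, 𝓕 (fun w : E => Complex.exp (-(c : ℂ)⁻¹ * (‖w‖ : ℂ) ^ 2 +
          2 * Real.pi * Complex.I * ((inner ℝ (0 : E) w : ℝ) : ℂ))) w • f w := by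
      simpa using! (VectorFourier.integral_fourierIntegral_smul_eq_flip (L := innerₗ E)
        Real.continuous_fourierChar continuous_inner J hf).symm
    rw [h1]
    congr with w
    rw [fourier_gaussian_innerProductSpace' (by simpa)]
    rw [div_inv_eq_mul, div_inv_eq_mul]
    congr 3
    ring
  have hre : ∀ w, 𝓕 f w = (((𝓕 f w).re : ℝ) : ℂ) := fun w =>
    Complex.ext (by simp) (by simp [(hpos w).2])
  have hnorm : ∀ w, ‖𝓕 f w‖ = (𝓕 f w).re := fun w => by
    rw [hre w, Complex.norm_real, Real.norm_of_nonneg (hpos w).1, Complex.ofReal_re]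
  obtain ⟨A, hA⟩ : ∃ A, ∀ w, ‖𝓕 f w‖ ≤ A :=
    ⟨_, VectorFourier.norm_fourierIntegral_le_integral_norm _ _ _ f⟩
  -- the damped integrals along `c = n + 1`, as lower Lebesgue integrals
  have hseq : Tendsto (fun n : ℕ => ((n : ℝ) + 1)) atTop atTop :=
    tendsto_atTop_add_const_right _ _ tendsto_natCast_atTop_atTop
  have hdamp : ∀ n : ℕ, ∫⁻ w : E, ENNReal.ofReal (Real.exp (-((n : ℝ) + 1)⁻¹ * ‖w‖ ^ 2) * ‖𝓕 f w‖)
      = ENNReal.ofReal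
        ‖∫ w : E, Complex.exp (-(((n : ℝ) + 1 : ℝ) : ℂ)⁻¹ * (‖w‖ : ℂ) ^ 2) • 𝓕 f w‖ := by
    intro n
    have hi : Integrable (fun w : E => Real.exp (-((n : ℝ) + 1)⁻¹ * ‖w‖ ^ 2) * ‖𝓕 f w‖) :=
      (integrable_exp_neg_mul_norm_sq (by positivity)).mul_bdd (c := A)
        hFc.norm.aestronglyMeasurable (Eventually.of_forall fun w => by simpa using hA w)
    rw [← ofReal_integral_eq_lintegral_ofReal hi (Eventually.of_forall fun w => by positivity)]
    congr 1
    have : ∫ w : E, Complex.exp (-(((n : ℝ) + 1 : ℝ) : ℂ)⁻¹ * (‖w‖ : ℂ) ^ 2) • 𝓕 f w =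
        ((∫ w : E, Real.exp (-((n : ℝ) + 1)⁻¹ * ‖w‖ ^ 2) * ‖𝓕 f w‖ : ℝ) : ℂ) := by
      rw [← integral_complex_ofReal]
      congr 1 with w
      rw [hnorm w]
      conv_lhs => rw [hre w]
      push_cast
      simp
    rw [this, Complex.norm_real, Real.norm_of_nonneg (integral_nonneg fun w => by positivity)]
  refine ⟨hFc.aestronglyMeasurable, ?_⟩
  rw [hasFiniteIntegral_iff_norm]
  have hlim : ∀ w : E, Tendsto (fun n : ℕ =>
      ENNReal.ofReal (Real.exp (-((n : ℝ) + 1)⁻¹ * ‖w‖ ^ 2) * ‖𝓕 f w‖)) atTop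
      (𝓝 (ENNReal.ofReal ‖𝓕 f w‖)) := by
    intro w
    refine ENNReal.tendsto_ofReal ?_
    have : Tendsto (fun n : ℕ => Real.exp (-((n : ℝ) + 1)⁻¹ * ‖w‖ ^ 2) * ‖𝓕 f w‖) atTop
        (𝓝 (Real.exp (-0 * ‖w‖ ^ 2) * ‖𝓕 f w‖)) := by
      refine Tendsto.mul_const _ ((Real.continuous_exp.tendsto _).comp ?_)
      exact ((tendsto_inv_atTop_zero.comp hseq).neg).mul_const _
    simpa using this
  calc ∫⁻ w, ENNReal.ofReal ‖𝓕 f w‖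
      = ∫⁻ w : E, liminf (fun n : ℕ =>
          ENNReal.ofReal (Real.exp (-((n : ℝ) + 1)⁻¹ * ‖w‖ ^ 2) * ‖𝓕 f w‖)) atTop := by
        congr 1 with w
        exact (hlim w).liminf_eq.symm
    _ ≤ liminf (fun n : ℕ => ∫⁻ w : E,
          ENNReal.ofReal (Real.exp (-((n : ℝ) + 1)⁻¹ * ‖w‖ ^ 2) * ‖𝓕 f w‖)) atTop :=
        lintegral_liminf_le fun n => by
          have := hFc.measurable
          fun_prop
    _ = ENNReal.ofReal ‖f 0‖ := by
        simp only [hdamp]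
        exact ((ENNReal.continuous_ofReal.tendsto _).comp
          ((B.comp hseq).norm)).liminf_eq
    _ < ⊤ := ENNReal.ofReal_lt_top

/-- A continuous integrable function with nonnegative Fourier transform and value `1` at the origin
is the characteristic function of a probability measure: by Fourier inversion its Fourier transform
is a density, up to the scaling by `2π` between Mathlib's Fourier transform and `charFun`. -/
theorem exists_charFun_eq_of_fourier_nonneg {f : E → ℂ} (hf : Integrable f) (hc : Continuous f)
    (h0 : f 0 = 1) (hpos : ∀ w, 0 ≤ (𝓕 f w).re ∧ (𝓕 f w).im = 0) :
    ∃ μ : Measure E, IsProbabilityMeasure μ ∧ ∀ t, charFun μ t = f t := by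
  have hi := integrable_fourier_of_nonneg hf hc hpos
  have hinv := hc.fourierInv_fourier_eq hf hi
  have hre : ∀ w, 𝓕 f w = (((𝓕 f w).re : ℝ) : ℂ) := fun w =>
    Complex.ext (by simp) (by simp [(hpos w).2])
  have hFc : Continuous (𝓕 f) :=
    VectorFourier.fourierIntegral_continuous Real.continuous_fourierChar
      (L := innerₗ E) continuous_inner hf
  have hFm : Measurable (fun w => (𝓕 f w).re) := (Complex.continuous_re.comp hFc).measurable
  let ν : Measure E := volume.withDensity (fun w => ENNReal.ofReal (𝓕 f w).re)
  let μ : Measure E := ν.map (fun w => (2 * Real.pi) • w)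
  have hchar : ∀ t, charFun μ t = f t := by
    intro t
    rw [charFun_apply, integral_map (by fun_prop) (by fun_prop)]
    simp only [ν]
    rw [integral_withDensity_eq_integral_toReal_smul (by fun_prop)
      (Eventually.of_forall fun w => ENNReal.ofReal_lt_top)]
    conv_rhs => rw [← hinv, Real.fourierInv_eq']
    congr 1 with w
    rw [ENNReal.toReal_ofReal (hpos w).1]
    conv_rhs => rw [hre w]
    rw [inner_smul_left, smul_eq_mul, Complex.real_smul, mul_comm]
    simp
  have hfin : IsFiniteMeasure ν :=
    isFiniteMeasure_withDensity_ofReal hi.re.2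
  have hfin' : IsFiniteMeasure μ := by infer_instance
  refine ⟨μ, ⟨?_⟩, hchar⟩
  have h1 := hchar 0
  rw [charFun_zero, h0] at h1
  have h2 : μ.real Set.univ = 1 := by exact_mod_cast h1
  exact (ENNReal.toReal_eq_one_iff _).mp h2

/-- **Bochner's theorem** in finite dimension: a continuous positive definite function that is
`1` at the origin is the characteristic function of a probability measure. -/
theorem IsPosDefFun.exists_charFun_eq {C : E → ℂ} (hC : IsPosDefFun C) (hc : Continuous C)
    (h0 : C 0 = 1) : ∃ μ : Measure E, IsProbabilityMeasure μ ∧ ∀ t, charFun μ t = C t := by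
  -- Gaussian damping makes `C` integrable; the damped functions converge to `C`
  have hstep : ∀ n : ℕ, ∃ μ : Measure E, IsProbabilityMeasure μ ∧
      ∀ t, charFun μ t = Real.exp (-((n : ℝ) + 1)⁻¹ * ‖t‖ ^ 2) • C t := by
    intro n
    have hb : (0 : ℝ) < ((n : ℝ) + 1)⁻¹ := by positivity
    refine exists_charFun_eq_of_fourier_nonneg ?_ (by fun_prop) (by simp [h0])
      (fun w => hC.fourier_gaussian_nonneg hc h0 hb w)
    refine (integrable_exp_neg_mul_norm_sq (E := E) hb).mono'
      (Continuous.aestronglyMeasurable (by fun_prop)) (Eventually.of_forall fun w => ?_)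
    rw [norm_smul, Real.norm_of_nonneg (by positivity)]
    exact mul_le_of_le_one_right (by positivity) (hC.norm_le_one h0 w)
  choose μ hμ hμC using hstep
  have hseq : Tendsto (fun n : ℕ => ((n : ℝ) + 1)) atTop atTop :=
    tendsto_atTop_add_const_right _ _ tendsto_natCast_atTop_atTop
  have hlim : ∀ t, Tendsto (fun n => charFun (μ n) t) atTop (𝓝 (C t)) := by
    intro t
    simp only [hμC]
    have : Tendsto (fun n : ℕ => Real.exp (-((n : ℝ) + 1)⁻¹ * ‖t‖ ^ 2) • C t) atTop
        (𝓝 (Real.exp (-0 * ‖t‖ ^ 2) • C t)) := by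
      refine Tendsto.smul_const ((Real.continuous_exp.tendsto _).comp ?_) _
      exact ((tendsto_inv_atTop_zero.comp hseq).neg).mul_const _
    simpa using this
  -- continuity of `C` at the origin gives tightness, hence a weak limit point
  have htight := isTightMeasureSet_of_tendsto_charFun hc.continuousAt hlim
  let P : ℕ → ProbabilityMeasure E := fun n => ⟨μ n, hμ n⟩
  have hcomp : IsCompact (closure (Set.range P)) :=
    isCompact_closure_of_isTightMeasureSet (htight.subset (by
      rintro _ ⟨_, ⟨n, rfl⟩, rfl⟩
      exact ⟨n, rfl⟩))
  let U : Ultrafilter ℕ := Ultrafilter.of atTop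
  obtain ⟨ν, -, hν : Tendsto P U (𝓝 ν)⟩ := hcomp.ultrafilter_le_nhds (U.map P) (by
    rw [Ultrafilter.coe_map, le_principal_iff, mem_map]
    exact univ_mem' fun n => subset_closure ⟨n, rfl⟩)
  refine ⟨ν, inferInstance, fun t => ?_⟩
  rw [ProbabilityMeasure.tendsto_iff_forall_integral_rclike_tendsto ℂ] at hν
  have h1 := hν (BoundedContinuousFunction.innerProbChar t)
  simp only [← charFun_eq_integral_innerProbChar] at h1
  exact tendsto_nhds_unique h1 ((hlim t).mono_left (Ultrafilter.of_le atTop))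

end Bochner

/-! ### Kolmogorov's extension theorem on Polish spaces -/

section Kolmogorov

variable {ι : Type*} {α : ι → Type*} [∀ i, TopologicalSpace (α i)] [∀ i, PolishSpace (α i)]
  [∀ i, MeasurableSpace (α i)] [∀ i, BorelSpace (α i)]
  {P : ∀ J : Finset ι, Measure (Π j : J, α j)} [∀ J, IsProbabilityMeasure (P J)]

/-- The content of a projective family on Polish spaces is continuous at `∅`. Compact sets
approximate the bases of the cylinders from inside, and a limit along an ultrafilter of points of
the finite intersections lies in all of them. -/
theorem tendsto_projectiveFamilyContent_zero (hP : IsProjectiveMeasureFamily P)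
    {A : ℕ → Set (Π i, α i)} (hA : ∀ n, A n ∈ measurableCylinders α) (hanti : Antitone A)
    (hemp : ⋂ n, A n = ∅) :
    Tendsto (fun n => projectiveFamilyContent hP (A n)) atTop (𝓝 0) := by
  have hne : ∀ i, Nonempty (α i) := fun i =>
    (nonempty_of_isProbabilityMeasure (P {i})).map fun x => x ⟨i, by simp⟩
  set m := projectiveFamilyContent hP with hm
  have hmono : Antitone fun n => m (A n) := fun i j hij =>
    projectiveFamilyContent_mono hP (hA j) (hA i) (hanti hij)
  by_contra hlim
  obtain ⟨ε, hε0, hε⟩ : ∃ ε : ℝ≥0∞, ε ≠ 0 ∧ ∀ n, ε ≤ m (A n) := by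
    refine ⟨⨅ n, m (A n), fun h => hlim ?_, fun n => iInf_le _ n⟩
    rw [← h]
    exact tendsto_atTop_iInf hmono
  obtain ⟨δ, hδ0, hδ⟩ := ENNReal.exists_pos_sum_of_countable' hε0 ℕ
  have hcyl : ∀ n, ∃ s S, MeasurableSet S ∧ A n = cylinder s S := fun n =>
    (mem_measurableCylinders _).1 (hA n)
  choose s S hS hAS using hcyl
  have hK : ∀ n, ∃ K ⊆ S n, (IsCompact K ∧ IsClosed K) ∧ P (s n) (S n) < P (s n) K + δ n := fun n =>
    (innerRegular_isCompact_isClosed_measurableSet_of_finite (P (s n))).exists_subset_lt_add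
      ⟨isCompact_empty, isClosed_empty⟩ (hS n) (measure_ne_top _ _) (hδ0 n).ne'
  choose K hKS hKc hKm using hK
  have hKmeas : ∀ n, MeasurableSet (K n) := fun n => (hKc n).2.measurableSet
  -- the cylinders over `K n` differ from `A n` by at most `δ n`, and `∑ δ n < ε`, so their finite
  -- intersections are nonempty
  have hdiff : ∀ n, m (cylinder (s n) (S n \ K n)) ≤ δ n := by
    intro n
    rw [hm, projectiveFamilyContent_cylinder hP ((hS n).diff (hKmeas n)),
      measure_sdiff (hKS n) (hKmeas n).nullMeasurableSet (measure_ne_top _ _)]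
    exact tsub_le_iff_left.mpr (hKm n).le
  have hx : ∀ N, ∃ x : Π i, α i, ∀ k ≤ N, x ∈ cylinder (s k) (K k) := by
    intro N
    by_contra hcon
    push Not at hcon
    have hsub : A N ⊆ ⋃ k ∈ Finset.range (N + 1), cylinder (s k) (S k \ K k) := by
      intro x hx
      obtain ⟨k, hkN, hk⟩ := hcon x
      have hxk : x ∈ cylinder (s k) (S k) := by rw [← hAS]; exact hanti hkN hx
      simp only [Set.mem_iUnion, Finset.mem_range]
      exact ⟨k, by omega, hxk, hk⟩
    have hmem : ∀ k ∈ Finset.range (N + 1),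
        cylinder (s k) (S k \ K k) ∈ measurableCylinders α := fun k _ =>
      cylinder_mem_measurableCylinders _ _ ((hS k).diff (hKmeas k))
    have h1 : m (A N) ≤ ∑ k ∈ Finset.range (N + 1), δ k :=
      calc m (A N) ≤ m (⋃ k ∈ Finset.range (N + 1), cylinder (s k) (S k \ K k)) :=
            projectiveFamilyContent_mono hP (hA N)
              (isSetRing_measurableCylinders.biUnion_mem _ hmem) hsub
        _ ≤ ∑ k ∈ Finset.range (N + 1), m (cylinder (s k) (S k \ K k)) :=
            addContent_biUnion_le isSetRing_measurableCylinders hmem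
        _ ≤ ∑ k ∈ Finset.range (N + 1), δ k := Finset.sum_le_sum fun k _ => hdiff k
    exact absurd (((hε N).trans h1).trans (ENNReal.sum_le_tsum _)) (not_le.mpr hδ)
  choose x hx using hx
  -- coordinates that occur in some base converge along an ultrafilter by compactness, the others
  -- are irrelevant
  let U : Ultrafilter ℕ := Ultrafilter.of atTop
  have hU : (U : Filter ℕ) ≤ atTop := Ultrafilter.of_le atTop
  have hy : ∀ i, ∃ y : α i, (∃ k, i ∈ s k) → Tendsto (fun N => x N i) U (𝓝 y) := by
    intro i
    by_cases h : ∃ k, i ∈ s k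
    · obtain ⟨k, hk⟩ := h
      have hc : IsCompact ((fun z : Π j : s k, α j => z ⟨i, hk⟩) '' K k) :=
        (hKc k).1.image (continuous_apply _)
      obtain ⟨y, -, hy : Tendsto _ _ _⟩ := hc.ultrafilter_le_nhds (U.map fun N => x N i) (by
        rw [Ultrafilter.coe_map, le_principal_iff, mem_map]
        filter_upwards [hU (Ici_mem_atTop k)] with N hN
        exact ⟨_, hx N k hN, rfl⟩)
      exact ⟨y, fun _ => hy⟩
    · exact ⟨Classical.arbitrary _, fun h' => absurd h' h⟩
  choose y hy using hy
  have hmem : ∀ k, y ∈ A k := by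
    intro k
    rw [hAS]
    refine hKS k ((hKc k).2.mem_of_tendsto (f := fun N => (s k).restrict (x N)) (b := U) ?_ ?_)
    · exact tendsto_pi_nhds.mpr fun j => hy j ⟨k, j.2⟩
    · filter_upwards [hU (Ici_mem_atTop k)] with N hN using hx N k hN
  have : y ∈ ⋂ n, A n := Set.mem_iInter.mpr hmem
  rw [hemp] at this
  exact this

/-- **Kolmogorov's extension theorem** on Polish spaces. -/
theorem exists_isProjectiveLimit (hP : IsProjectiveMeasureFamily P) :
    ∃ μ : Measure (Π i, α i), IsProjectiveLimit μ P := by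
  have hsub : (projectiveFamilyContent hP).IsSigmaSubadditive :=
    isSigmaSubadditive_of_addContent_iUnion_eq_tsum isSetRing_measurableCylinders
      (fun f hf hf_Union hf' =>
        addContent_iUnion_eq_sum_of_tendsto_zero isSetRing_measurableCylinders
          (projectiveFamilyContent hP) (fun s hs => projectiveFamilyContent_ne_top _)
          (fun _ h1 h2 h3 => tendsto_projectiveFamilyContent_zero hP h1 h2 h3) hf hf_Union hf')
  refine ⟨(projectiveFamilyContent hP).measure isSetSemiring_measurableCylinders
    generateFrom_measurableCylinders.ge hsub, fun I => ?_⟩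
  ext s hs
  rw [Measure.map_apply (Finset.measurable_restrict I) hs, AddContent.measure_eq, ← cylinder,
    projectiveFamilyContent_cylinder hP hs]
  · exact generateFrom_measurableCylinders.symm
  · exact cylinder_mem_measurableCylinders _ _ hs

end Kolmogorov

/-! ### Linear processes with a given characteristic functional -/

section LinearProcess

theorem IsPosDefFun.comp_addMonoidHom {V W : Type*} [AddGroup V] [AddGroup W] {C : W → ℂ}
    (hC : IsPosDefFun C) (T : V →+ W) : IsPosDefFun (fun v => C (T v)) := by
  intro n f z
  simpa only [map_sub] using hC n (fun j => T (f j)) z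

/-- Finite measures on `ℝᴶ` with the same characteristic function are equal. -/
theorem measure_pi_ext_of_integral_exp {J : Type*} [Fintype J] {μ ν : Measure (J → ℝ)}
    [IsFiniteMeasure μ] [IsFiniteMeasure ν]
    (h : ∀ t : J → ℝ, ∫ x, Complex.exp (((∑ j, x j * t j : ℝ) : ℂ) * Complex.I) ∂μ =
      ∫ x, Complex.exp (((∑ j, x j * t j : ℝ) : ℂ) * Complex.I) ∂ν) : μ = ν := by
  refine (MeasurableEquiv.toLp 2 (J → ℝ)).map_measurableEquiv_injective ?_
  refine Measure.ext_of_charFun (funext fun t => ?_)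
  rw [charFun_apply, charFun_apply, integral_map_equiv, integral_map_equiv]
  have := h t.ofLp
  simpa [PiLp.inner_apply, mul_comm] using this

variable {V : Type*} [AddCommGroup V] [Module ℝ V] [TopologicalSpace V]
  [IsTopologicalAddGroup V] [ContinuousSMul ℝ V] {C : V → ℂ}

/-- The finite-dimensional laws prescribed by a positive definite functional. -/
theorem IsPosDefFun.exists_measure_pi {J : Type*} [Fintype J] (hC : IsPosDefFun C)
    (hc : Continuous C) (h0 : C 0 = 1) (b : J → V) :
    ∃ μ : Measure (J → ℝ), IsProbabilityMeasure μ ∧ ∀ t : J → ℝ,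
      ∫ x, Complex.exp (((∑ j, x j * t j : ℝ) : ℂ) * Complex.I) ∂μ = C (∑ j, t j • b j) := by
  let T : EuclideanSpace ℝ J →ₗ[ℝ] V :=
    { toFun := fun t => ∑ j, t j • b j
      map_add' := fun s t => by simp [add_smul, Finset.sum_add_distrib]
      map_smul' := fun r t => by simp [Finset.smul_sum, mul_smul] }
  have hT : Continuous T := by
    change Continuous fun t : EuclideanSpace ℝ J => ∑ j, t j • b j
    fun_prop
  obtain ⟨μ, hμ, hμC⟩ := (hC.comp_addMonoidHom T.toAddMonoidHom).exists_charFun_eq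
    (hc.comp hT) (by simp [h0])
  refine ⟨μ.map (MeasurableEquiv.toLp 2 (J → ℝ)).symm,
    Measure.isProbabilityMeasure_map (by fun_prop), fun t => ?_⟩
  rw [integral_map_equiv]
  have := hμC (WithLp.toLp 2 t)
  rw [charFun_apply] at this
  simpa [PiLp.inner_apply, mul_comm, T] using this

/-- Every continuous positive definite functional that is `1` at the origin is the characteristic
functional of a process that is linear in its index. The values on a Hamel basis are
given by Kolmogorov's extension theorem and extended linearly. -/
theorem IsPosDefFun.exists_linear_process {V : Type} [AddCommGroup V] [Module ℝ V]
    [TopologicalSpace V] [IsTopologicalAddGroup V] [ContinuousSMul ℝ V] {C : V → ℂ}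
    (hC : IsPosDefFun C) (hc : Continuous C) (h0 : C 0 = 1) :
    ∃ (Ω : Type) (_ : MeasurableSpace Ω) (P : Measure Ω) (_ : IsProbabilityMeasure P)
      (φ : V → Ω → ℝ), (∀ f, Measurable (φ f)) ∧ (∀ ω, IsLinearMap ℝ (fun f => φ f ω)) ∧
        ∀ f, C f = ∫ ω, Complex.exp (Complex.I * (φ f ω : ℂ)) ∂P := by
  classical
  let b := Module.Basis.ofVectorSpace ℝ V
  choose P hP hPC using fun J : Finset (Module.Basis.ofVectorSpaceIndex ℝ V) =>
    hC.exists_measure_pi hc h0 (fun j : J => b j)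
  have hproj : IsProjectiveMeasureFamily (α := fun _ : Module.Basis.ofVectorSpaceIndex ℝ V => ℝ)
      P := by
    intro I J hJI
    refine measure_pi_ext_of_integral_exp fun t => ?_
    rw [hPC]
    refine Eq.trans ?_ (integral_map (μ := P I)
      (φ := Finset.restrict₂ (π := fun _ : Module.Basis.ofVectorSpaceIndex ℝ V => ℝ) hJI)
      (Finset.measurable_restrict₂ hJI).aemeasurable
      (f := fun x : J → ℝ => Complex.exp (((∑ j, x j * t j : ℝ) : ℂ) * Complex.I))
      (Continuous.aestronglyMeasurable (by fun_prop))).symm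
    -- the characteristic function of a marginal is obtained by extending the argument by zero
    let t' : I → ℝ := fun i => if h : (i : Module.Basis.ofVectorSpaceIndex ℝ V) ∈ J
      then t ⟨i, h⟩ else 0
    have hsum : ∀ {M : Type} [AddCommMonoid M] (F : I → M) (G : J → M)
        (_ : ∀ j : J, F ⟨j, hJI j.2⟩ = G j)
        (_ : ∀ i : I, (i : Module.Basis.ofVectorSpaceIndex ℝ V) ∉ J → F i = 0),
        ∑ i, F i = ∑ j, G j := by
      intro M _ F G h1 h2
      symm
      refine Finset.sum_of_injOn (fun j => ⟨j, hJI j.2⟩) ?_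
        (fun _ _ => Finset.mem_coe.2 (Finset.mem_univ _)) ?_ (fun j _ => (h1 j).symm)
      · intro x _ y _ h
        exact Subtype.ext (congrArg (fun i : I => (i : Module.Basis.ofVectorSpaceIndex ℝ V)) h)
      · intro i _ hi
        refine h2 i fun hiJ => hi ⟨⟨i, hiJ⟩, Finset.mem_coe.2 (Finset.mem_univ _), rfl⟩
    have e1 := hPC I t'
    rw [hsum (fun i => t' i • b i) (fun j => t j • b j) (fun j => by simp [t', j.2])
      (fun i hi => by simp [t', hi])] at e1
    rw [← e1]
    congr 1 with x
    rw [hsum (fun i => x i * t' i) (fun j => Finset.restrict₂ (π := fun _ => ℝ) hJI x j * t j)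
      (fun j => by simp [t']) (fun i hi => by simp [t', hi])]
  obtain ⟨μ, hμ⟩ := exists_isProjectiveLimit hproj
  have : IsProbabilityMeasure μ := hμ.isProbabilityMeasure
  have hφ : ∀ (f : V) (ω : Module.Basis.ofVectorSpaceIndex ℝ V → ℝ),
      Finsupp.linearCombination ℝ ω (b.repr f) = ∑ i ∈ (b.repr f).support, ω i * b.repr f i := by
    intro f ω
    rw [Finsupp.linearCombination_apply, Finsupp.sum]
    exact Finset.sum_congr rfl fun i _ => by rw [smul_eq_mul, mul_comm]
  refine ⟨Module.Basis.ofVectorSpaceIndex ℝ V → ℝ, inferInstance, μ, this,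
    fun f ω => Finsupp.linearCombination ℝ ω (b.repr f), fun f => ?_, fun ω => ?_, fun f => ?_⟩
  · simp only [hφ]
    fun_prop
  · exact ⟨fun f h => by simp, fun r f => by simp⟩
  · have h1 := hPC (b.repr f).support (fun j => b.repr f j)
    rw [← hμ (b.repr f).support, integral_map (by fun_prop)
      (Continuous.aestronglyMeasurable (by fun_prop))] at h1
    have h2 : ∑ j : (b.repr f).support, b.repr f j • b j = f := by
      conv_rhs => rw [← b.linearCombination_repr f, Finsupp.linearCombination_apply, Finsupp.sum]
      exact Finset.sum_coe_sort (b.repr f).support fun i => b.repr f i • b i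
    rw [h2] at h1
    rw [← h1]
    congr 1 with ω
    simp only [hφ]
    rw [mul_comm]
    congr 3
    exact (Finset.sum_coe_sort (b.repr f).support fun i => ω i * b.repr f i)

end LinearProcess

/-! ### Positive semidefinite kernels -/

section Kernels

/-- Complex positive semidefiniteness in terms of the quadratic form `∑ zⱼ z̄ₖ Aⱼₖ`. -/
theorem posSemidef_iff_sum_nonneg {n : ℕ} {A : Matrix (Fin n) (Fin n) ℂ} (hA : A.IsHermitian) :
    A.PosSemidef ↔ ∀ z : Fin n → ℂ, 0 ≤ ∑ j, ∑ k, z j * star (z k) * A j k := by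
  have e : ∀ z : Fin n → ℂ, star z ⬝ᵥ (A *ᵥ z) =
      ∑ j, ∑ k, star z j * star (star z k) * A j k := by
    intro z
    simp only [dotProduct, Matrix.mulVec, Finset.mul_sum, Pi.star_apply, star_star]
    exact Finset.sum_congr rfl fun j _ => Finset.sum_congr rfl fun k _ => by ring
  rw [Matrix.posSemidef_iff_dotProduct_mulVec]
  simp only [hA, true_and, e]
  exact ⟨fun h z => by simpa using h (star z), fun h z => h (star z)⟩

/-- Powers of a positive semidefinite matrix for the entrywise product. -/
theorem posSemidef_entrywise_pow {n : ℕ} {A : Matrix (Fin n) (Fin n) ℂ} (hA : A.PosSemidef)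
    (m : ℕ) : (Matrix.of fun j k => A j k ^ m).PosSemidef := by
  induction m with
  | zero =>
    have h := Matrix.posSemidef_self_mul_conjTranspose
      (Matrix.of fun (_ : Fin n) (_ : Fin 1) => (1 : ℂ))
    convert! h using 1
    ext j k
    simp [Matrix.mul_apply]
  | succ m ih =>
    convert! ih.hadamard hA using 1

/-- The entrywise exponential of a positive semidefinite matrix is positive semidefinite: its
power series has positive semidefinite terms by the Schur product theorem. -/
theorem posSemidef_entrywise_exp {n : ℕ} {A : Matrix (Fin n) (Fin n) ℂ} (hA : A.PosSemidef) :
    (Matrix.of fun j k => Complex.exp (A j k)).PosSemidef := by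
  have hH : (Matrix.of fun j k => Complex.exp (A j k)).IsHermitian := by
    ext j k
    simp only [Matrix.conjTranspose_apply, Matrix.of_apply, Complex.star_def, ← Complex.exp_conj]
    rw [← Complex.star_def, hA.1.apply]
  rw [posSemidef_iff_sum_nonneg hH]
  intro z
  have hs : HasSum (fun m : ℕ => ∑ j, ∑ k, z j * star (z k) * ((m.factorial : ℂ)⁻¹ * A j k ^ m))
      (∑ j, ∑ k, z j * star (z k) * (Matrix.of fun j k => Complex.exp (A j k)) j k) := by
    refine hasSum_sum fun j _ => hasSum_sum fun k _ => HasSum.mul_left _ ?_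
    simpa [div_eq_inv_mul, Complex.exp_eq_exp_ℂ] using NormedSpace.expSeries_div_hasSum_exp (A j k)
  refine hs.nonneg fun m => ?_
  have hm := posSemidef_entrywise_pow hA m
  have h := (posSemidef_iff_sum_nonneg hm.1).mp hm z
  have e : ∑ j, ∑ k, z j * star (z k) * ((m.factorial : ℂ)⁻¹ * A j k ^ m) =
      ((m.factorial : ℝ)⁻¹ : ℝ) * ∑ j, ∑ k, z j * star (z k) * A j k ^ m := by
    simp only [Finset.mul_sum]
    refine Finset.sum_congr rfl fun j _ => Finset.sum_congr rfl fun k _ => ?_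
    push_cast
    ring
  rw [e]
  exact mul_nonneg (by exact_mod_cast by positivity) h

/-- **Schoenberg's criterion**: `exp ∘ B` is positive definite as soon as `B (f - h)` is a positive
semidefinite kernel up to a term of the form `a f + conj (a h)`. -/
theorem isPosDefFun_exp {V : Type*} [AddGroup V] {B : V → ℂ} {K : V → V → ℂ} {a : V → ℂ}
    (hB : ∀ f h, B (f - h) = K f h + a f + star (a h))
    (hK : ∀ (n : ℕ) (f : Fin n → V), (Matrix.of fun j k => K (f j) (f k)).PosSemidef) :
    IsPosDefFun fun f => Complex.exp (B f) := by
  intro n f z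
  have hexp := posSemidef_entrywise_exp (hK n f)
  have h := (posSemidef_iff_sum_nonneg hexp.1).mp hexp fun j => z j * Complex.exp (a (f j))
  have e : ∑ j, ∑ k, z j * star (z k) * Complex.exp (B (f j - f k)) =
      ∑ j, ∑ k, (z j * Complex.exp (a (f j))) * star (z k * Complex.exp (a (f k))) *
        (Matrix.of fun j k =>
          Complex.exp ((Matrix.of fun j k => K (f j) (f k)) j k)) j k := by
    refine Finset.sum_congr rfl fun j _ => Finset.sum_congr rfl fun k _ => ?_
    have : star (Complex.exp (a (f k))) = Complex.exp (star (a (f k))) := by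
      rw [Complex.star_def, ← Complex.exp_conj]
    rw [star_mul', this, hB, Complex.exp_add, Complex.exp_add]
    simp only [Matrix.of_apply]
    ring
  rw [e]
  rw [Complex.nonneg_iff] at h
  exact ⟨h.1, h.2.symm⟩

end Kernels

/-! ### Laws determined by the characteristic functional -/

section Laws

variable {d L : ℕ} {Ω : Type*} [MeasurableSpace Ω] {φ : TestFn d L → Ω → ℝ} {P : Measure Ω}
  {C : TestFn d L → ℂ}

/-- By almost sure linearity, the characteristic functional determines the laws. -/
theorem HasCharFunctional.charFun_eq (hφ : ∀ f, Measurable (φ f))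
    (hlin : ∀ᵐ ω ∂P, IsLinearMap ℝ (fun f => φ f ω)) (hC : HasCharFunctional φ P C)
    (f : TestFn d L) (t : ℝ) : charFun (P.map (φ f)) t = C (t • f) := by
  have := hφ f
  rw [charFun_apply_real, hC, integral_map (by fun_prop) (by fun_prop)]
  refine integral_congr_ae ?_
  filter_upwards [hlin] with ω hω
  rw [hω.map_smul]
  congr 1
  simp
  ring

variable [IsProbabilityMeasure P]

theorem HasCharFunctional.tendsto_law (hφ : ∀ f, Measurable (φ f))
    (hlin : ∀ᵐ ω ∂P, IsLinearMap ℝ (fun f => φ f ω)) (hC : HasCharFunctional φ P C)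
    (hc : Continuous C) (u : ℕ → TestFn d L) (f : TestFn d L) (hu : Tendsto u atTop (𝓝 f)) :
    TendstoInDistribution (fun n => φ (u n)) atTop (φ f) (fun _ => P) P where
  forall_aemeasurable n := (hφ (u n)).aemeasurable
  aemeasurable_limit := (hφ f).aemeasurable
  tendsto := by
    refine ProbabilityMeasure.tendsto_of_tendsto_charFun fun t => ?_
    simp only [ProbabilityMeasure.coe_mk, hC.charFun_eq hφ hlin]
    exact (hc.tendsto _).comp (hu.const_smul t)

/-- Every characteristic functional is that of a random vector field. -/
theorem IsCharFunctional.exists_randomVectorField (hC : IsCharFunctional C) :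
    ∃ (Ω : Type) (_ : MeasurableSpace Ω) (P : Measure Ω) (_ : IsProbabilityMeasure P)
      (F : TestFn d L → Ω → ℝ), IsRandomVectorField F P ∧ HasCharFunctional F P C := by
  obtain ⟨Ω, mΩ, P, hP, φ, hφ, hlin, hφC⟩ :=
    IsPosDefFun.exists_linear_process hC.posDef hC.continuous hC.map_zero
  have hlin' : ∀ᵐ ω ∂P, IsLinearMap ℝ (fun f => φ f ω) := Eventually.of_forall hlin
  exact ⟨Ω, mΩ, P, hP, φ, ⟨hφ, hlin', fun u f hu =>
    HasCharFunctional.tendsto_law hφ hlin' hφC hC.continuous u f hu⟩, hφC⟩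

theorem HasCharFunctional.identDistrib (hF : IsRandomVectorField φ P)
    (hC : HasCharFunctional φ P C) {f h : TestFn d L}
    (hfh : ∀ t : ℝ, C (t • f) = C (t • h)) : IdentDistrib (φ f) (φ h) P P where
  aemeasurable_fst := (hF.measurable f).aemeasurable
  aemeasurable_snd := (hF.measurable h).aemeasurable
  map_eq := by
    have := Measure.isProbabilityMeasure_map (μ := P) (hF.measurable f).aemeasurable
    have := Measure.isProbabilityMeasure_map (μ := P) (hF.measurable h).aemeasurable
    refine Measure.ext_of_charFun (funext fun t => ?_)
    rw [hC.charFun_eq hF.measurable hF.ae_linear, hC.charFun_eq hF.measurable hF.ae_linear, hfh]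

theorem HasCharFunctional.indepFun (hF : IsRandomVectorField φ P)
    (hC : HasCharFunctional φ P C) {f h : TestFn d L}
    (hfh : ∀ s t : ℝ, C (s • f + t • h) = C (s • f) * C (t • h)) : IndepFun (φ f) (φ h) P := by
  have h1 := hF.measurable f
  have h2 := hF.measurable h
  rw [indepFun_iff_charFun_prod h1.aemeasurable h2.aemeasurable]
  intro t
  rw [hC.charFun_eq hF.measurable hF.ae_linear, hC.charFun_eq hF.measurable hF.ae_linear, ← hfh,
    hC, charFun_apply, integral_map (by fun_prop) (by fun_prop)]
  refine integral_congr_ae ?_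
  filter_upwards [hF.ae_linear] with ω hω
  rw [hω.map_add, hω.map_smul, hω.map_smul]
  congr 1
  simp [WithLp.prod_inner_apply]
  ring

/-- A random vector field with characteristic functional `exp (-Q)`, `Q` nonnegative and
quadratic, is Gaussian. -/
theorem HasCharFunctional.isGaussianProcess (hF : IsRandomVectorField φ P)
    (hC : HasCharFunctional φ P C) {Q : TestFn d L → ℝ}
    (hQ : ∀ f, C f = Complex.exp (-(Q f : ℂ))) (hQ0 : ∀ f, 0 ≤ Q f)
    (hQ2 : ∀ (t : ℝ) f, Q (t • f) = t ^ 2 * Q f) : IsGaussianProcess φ P := by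
  have hone : ∀ f, P.map (φ f) = gaussianReal 0 (2 * (Q f).toNNReal) := by
    intro f
    have := Measure.isProbabilityMeasure_map (μ := P) (hF.measurable f).aemeasurable
    refine Measure.ext_of_charFun (funext fun t => ?_)
    rw [hC.charFun_eq hF.measurable hF.ae_linear, hQ, hQ2, charFun_gaussianReal]
    congr 1
    push_cast
    rw [Real.coe_toNNReal _ (hQ0 f)]
    ring
  -- a linear functional `ℓ` of the values of `φ` on `I` is almost surely the single value `φ g`
  refine ⟨fun I => ⟨isGaussian_of_map_eq_gaussianReal fun ℓ => ?_⟩⟩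
  classical
  let g : TestFn d L := ∑ i : I, ℓ (Pi.single i 1) • (i : TestFn d L)
  refine ⟨0, 2 * (Q g).toNNReal, ?_⟩
  have hm : Measurable fun ω => I.restrict (φ · ω) := by
    have := hF.measurable
    exact measurable_pi_lambda _ fun i => this i
  rw [← hone g, Measure.map_map (by fun_prop) hm]
  refine Measure.map_congr ?_
  filter_upwards [hF.ae_linear] with ω hω
  have e1 : φ g ω = hω.mk' _ g := rfl
  rw [e1, map_sum]
  simp only [map_smul, IsLinearMap.mk'_apply, Function.comp_apply]
  conv_lhs => rw [← Finset.univ_sum_single (I.restrict (φ · ω)), map_sum]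
  refine Finset.sum_congr rfl fun i _ => ?_
  have : (Pi.single i (I.restrict (φ · ω) i) : I → ℝ) = φ i ω • Pi.single i 1 := by
    rw [← Pi.single_smul]; simp
  rw [this, map_smul, smul_eq_mul, smul_eq_mul, mul_comm]

end Laws

/-! ### Lévy exponents -/

section LevyCharacteristic

variable {L : ℕ}

/-- The jump kernel `exp (i t·s) - 1` of the Lévy–Khinchine formula. -/
noncomputable def jump (t s : Vec L) : ℂ :=
  Complex.exp (Complex.I * ((inner ℝ t s : ℝ) : ℂ)) - 1

theorem continuous_jump (t : Vec L) : Continuous (jump t) := by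
  unfold jump; fun_prop

theorem norm_jump_le (t s : Vec L) : ‖jump t s‖ ≤ ‖t‖ * ‖s‖ :=
  Real.norm_exp_I_mul_ofReal_sub_one_le.trans (norm_inner_le_norm t s)

/-- Up to terms in `t` alone and in `u` alone, `jump (t - u)` is a rank-one positive semidefinite
kernel. -/
theorem jump_sub (t u s : Vec L) :
    jump (t - u) s = jump t s * star (jump u s) + jump t s + star (jump u s) := by
  have e : Complex.exp (Complex.I * ((inner ℝ t s - inner ℝ u s : ℝ) : ℂ)) =
      Complex.exp (Complex.I * ((inner ℝ t s : ℝ) : ℂ)) *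
        Complex.exp (-(Complex.I * ((inner ℝ u s : ℝ) : ℂ))) := by
    rw [← Complex.exp_add]
    push_cast
    ring_nf
  simp only [jump, inner_sub_left, star_sub, star_one, Complex.star_def, ← Complex.exp_conj,
    map_mul, Complex.conj_I, Complex.conj_ofReal, neg_mul, e]
  ring

theorem norm_jump_sub_jump_le (t u s : Vec L) : ‖jump t s - jump u s‖ ≤ ‖t - u‖ * ‖s‖ := by
  have e : jump t s - jump u s =
      Complex.exp (Complex.I * ((inner ℝ u s : ℝ) : ℂ)) * jump (t - u) s := by
    simp only [jump, inner_sub_left, mul_sub, mul_one, ← Complex.exp_add]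
    push_cast
    ring_nf
  rw [e, norm_mul, mul_comm Complex.I, Complex.norm_exp_ofReal_mul_I, one_mul]
  exact norm_jump_le _ _

variable {M : Measure (Vec L)}

theorem integrable_norm_of_moments (hM : ∀ n : ℕ, 1 ≤ n → Integrable (fun s => ‖s‖ ^ n) M) :
    Integrable (fun s => ‖s‖) M := by
  simpa using hM 1 le_rfl

theorem integrable_jump (hM : Integrable (fun s => ‖s‖) M) (t : Vec L) :
    Integrable (jump t) M :=
  (hM.const_mul ‖t‖).mono' (continuous_jump t).aestronglyMeasurable
    (Eventually.of_forall (norm_jump_le t))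

theorem integrable_jump_mul_star_jump (hM : Integrable (fun s => ‖s‖ ^ 2) M) (t u : Vec L) :
    Integrable (fun s => jump t s * star (jump u s)) M := by
  refine (hM.const_mul (‖t‖ * ‖u‖)).mono' ?_ (Eventually.of_forall fun s => ?_)
  · exact ((continuous_jump t).mul (continuous_jump u).star).aestronglyMeasurable
  · rw [norm_mul, norm_star]
    calc ‖jump t s‖ * ‖jump u s‖ ≤ (‖t‖ * ‖s‖) * (‖u‖ * ‖s‖) :=
          mul_le_mul (norm_jump_le t s) (norm_jump_le u s) (norm_nonneg _) (by positivity)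
      _ = ‖t‖ * ‖u‖ * ‖s‖ ^ 2 := by ring

theorem integrable_star {X : Type*} [MeasurableSpace X] {μ : Measure X} {f : X → ℂ}
    (hf : Integrable f μ) : Integrable (fun x => star (f x)) μ :=
  Complex.conjCLE.toContinuousLinearMap.integrable_comp hf

theorem sum_mul_star_nonneg {n : ℕ} (z w : Fin n → ℂ) :
    0 ≤ ∑ j, ∑ k, z j * star (z k) * (w j * star (w k)) := by
  have : ∑ j, ∑ k, z j * star (z k) * (w j * star (w k)) =
      (∑ j, z j * w j) * star (∑ k, z k * w k) := by
    rw [star_sum, Finset.sum_mul_sum]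
    refine Finset.sum_congr rfl fun j _ => Finset.sum_congr rfl fun k _ => ?_
    rw [star_mul']
    ring
  rw [this]
  exact mul_star_self_nonneg _

/-- The properties of a smooth Lévy characteristic on which the characteristic functional of the
noise field depends. The Lipschitz bound with linearly growing constant makes `∫ ψ (f x) dx` exist
and depend continuously on `f`; conditional positive definiteness, stated for the kernel
`ψ (s - t) - ψ s - conj (ψ t)`, gives the positive definiteness of the functional. -/
structure IsLevyExponent (ψ : Vec L → ℂ) : Prop where
  lipschitz : ∃ K : ℝ, 0 ≤ K ∧ ∀ s t, ‖ψ s - ψ t‖ ≤ K * ‖s - t‖ * (1 + ‖s‖ + ‖t‖)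
  map_zero : ψ 0 = 0
  sum_nonneg : ∀ (n : ℕ) (t : Fin n → Vec L) (z : Fin n → ℂ),
    0 ≤ ∑ j, ∑ k, z j * star (z k) * (ψ (t j - t k) - ψ (t j) - star (ψ (t k)))
  map_neg : ∀ t, ψ (-t) = star (ψ t)

theorem IsSmoothLevyCharacteristic.isLevyExponent {ψ : Vec L → ℂ}
    (hψ : IsSmoothLevyCharacteristic ψ) : IsLevyExponent ψ := by
  obtain ⟨a, σ, M, -, -, hM, hψ⟩ := hψ
  have hM1 : Integrable (fun s => ‖s‖) M := integrable_norm_of_moments hM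
  have hM2 := hM 2 (by norm_num)
  have hψ' : ∀ t, ψ t = Complex.I * ((inner ℝ a t : ℝ) : ℂ)
      - ((inner ℝ (matAct σ t) (matAct σ t) : ℝ) : ℂ) / 2 + ∫ s, jump t s ∂M := hψ
  have hdecomp : ∀ t u, ψ (t - u) - ψ t - star (ψ u) =
      ((inner ℝ (matAct σ t) (matAct σ u) : ℝ) : ℂ) + ∫ s, jump t s * star (jump u s) ∂M := by
    intro t u
    have h1 : ∫ s, jump (t - u) s ∂M =
        ∫ s, jump t s * star (jump u s) ∂M + ∫ s, jump t s ∂M + star (∫ s, jump u s ∂M) := by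
      have hs : star (∫ s, jump u s ∂M) = ∫ s, star (jump u s) ∂M := (integral_conj).symm
      have hadd : Integrable (fun s => jump t s * star (jump u s) + jump t s) M :=
        (integrable_jump_mul_star_jump hM2 t u).add (integrable_jump hM1 t)
      rw [hs, ← integral_add (integrable_jump_mul_star_jump hM2 t u) (integrable_jump hM1 t),
        ← integral_add hadd (integrable_star (integrable_jump hM1 u))]
      simp only [jump_sub]
    rw [hψ', hψ', hψ', h1]
    simp only [map_sub, inner_sub_left, inner_sub_right, star_add, star_sub, star_mul',
      Complex.star_def, Complex.conj_I, Complex.conj_ofReal, map_div₀, map_ofNat]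
    rw [real_inner_comm (matAct σ t) (matAct σ u)]
    push_cast
    ring
  have h0 : ψ 0 = 0 := by rw [hψ']; simp [jump]
  refine ⟨?_, h0, fun n t z => ?_, fun t => ?_⟩
  · refine ⟨‖a‖ + ‖matAct σ‖ ^ 2 + ∫ s, ‖s‖ ∂M, by positivity, fun s t => ?_⟩
    have h1 : ‖Complex.I * ((inner ℝ a s : ℝ) : ℂ) - Complex.I * ((inner ℝ a t : ℝ) : ℂ)‖ ≤
        ‖a‖ * ‖s - t‖ := by
      rw [← mul_sub, ← Complex.ofReal_sub, ← inner_sub_right, norm_mul, Complex.norm_I, one_mul,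
        Complex.norm_real]
      exact norm_inner_le_norm _ _
    have h2 : ‖((inner ℝ (matAct σ s) (matAct σ s) : ℝ) : ℂ) / 2 -
        ((inner ℝ (matAct σ t) (matAct σ t) : ℝ) : ℂ) / 2‖ ≤
        ‖matAct σ‖ ^ 2 * ‖s - t‖ * (‖s‖ + ‖t‖) := by
      have e : ((inner ℝ (matAct σ s) (matAct σ s) : ℝ) : ℂ) / 2 -
          ((inner ℝ (matAct σ t) (matAct σ t) : ℝ) : ℂ) / 2 =
          ((inner ℝ (matAct σ (s - t)) (matAct σ (s + t)) / 2 : ℝ) : ℂ) := by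
        simp only [map_sub, map_add, inner_sub_left, inner_add_right]
        rw [real_inner_comm (matAct σ s) (matAct σ t)]
        push_cast
        ring
      rw [e, Complex.norm_real]
      have b1 := (matAct σ).le_opNorm (s - t)
      have b2 := ((matAct σ).le_opNorm (s + t)).trans
        (mul_le_mul_of_nonneg_left (norm_add_le s t) (norm_nonneg _))
      calc ‖inner ℝ (matAct σ (s - t)) (matAct σ (s + t)) / 2‖
          ≤ ‖matAct σ (s - t)‖ * ‖matAct σ (s + t)‖ := by
            rw [norm_div, Real.norm_ofNat]
            have := norm_inner_le_norm (𝕜 := ℝ) (matAct σ (s - t)) (matAct σ (s + t))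
            have := norm_nonneg (inner ℝ (matAct σ (s - t)) (matAct σ (s + t)))
            linarith
        _ ≤ (‖matAct σ‖ * ‖s - t‖) * (‖matAct σ‖ * (‖s‖ + ‖t‖)) :=
            mul_le_mul b1 b2 (norm_nonneg _) (by positivity)
        _ = _ := by ring
    have h3 : ‖∫ x, jump s x ∂M - ∫ x, jump t x ∂M‖ ≤ ‖s - t‖ * ∫ x, ‖x‖ ∂M := by
      rw [← integral_sub (integrable_jump hM1 s) (integrable_jump hM1 t), ← integral_const_mul]
      exact norm_integral_le_of_norm_le (hM1.const_mul _)
        (Eventually.of_forall fun x => norm_jump_sub_jump_le s t x)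
    have hm : 0 ≤ ∫ x, ‖x‖ ∂M := integral_nonneg fun x => norm_nonneg x
    rw [hψ', hψ']
    calc _ = ‖(Complex.I * ((inner ℝ a s : ℝ) : ℂ) - Complex.I * ((inner ℝ a t : ℝ) : ℂ)) -
          (((inner ℝ (matAct σ s) (matAct σ s) : ℝ) : ℂ) / 2 -
            ((inner ℝ (matAct σ t) (matAct σ t) : ℝ) : ℂ) / 2) +
          (∫ x, jump s x ∂M - ∫ x, jump t x ∂M)‖ := by congr 1; ring
      _ ≤ ‖a‖ * ‖s - t‖ + ‖matAct σ‖ ^ 2 * ‖s - t‖ * (‖s‖ + ‖t‖) +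
          ‖s - t‖ * ∫ x, ‖x‖ ∂M :=
        (norm_add_le _ _).trans (add_le_add ((norm_sub_le _ _).trans (add_le_add h1 h2)) h3)
      _ ≤ _ := by
        have p1 : 0 ≤ ‖a‖ * ‖s - t‖ * (‖s‖ + ‖t‖) := by positivity
        have p2 : 0 ≤ ‖matAct σ‖ ^ 2 * ‖s - t‖ := by positivity
        have p3 : 0 ≤ ‖s - t‖ * (∫ x, ‖x‖ ∂M) * (‖s‖ + ‖t‖) := by positivity
        nlinarith
  · simp only [hdecomp, mul_add, Finset.sum_add_distrib]
    refine add_nonneg ?_ ?_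
    · have e : ∀ j k, z j * star (z k) *
          ((inner ℝ (matAct σ (t j)) (matAct σ (t k)) : ℝ) : ℂ) =
          ∑ i, z j * star (z k) *
            (((matAct σ (t j) i : ℝ) : ℂ) * star ((matAct σ (t k) i : ℝ) : ℂ)) := by
        intro j k
        rw [PiLp.inner_apply, Complex.ofReal_sum, Finset.mul_sum]
        refine Finset.sum_congr rfl fun i _ => ?_
        simp [mul_comm]
      simp only [e]
      rw [Finset.sum_congr rfl fun j _ => Finset.sum_comm, Finset.sum_comm]
      exact Finset.sum_nonneg fun i _ => sum_mul_star_nonneg z _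
    · have hi : ∀ j k, Integrable (fun s => z j * star (z k) *
          (jump (t j) s * star (jump (t k) s))) M := fun j k =>
        (integrable_jump_mul_star_jump hM2 _ _).const_mul _
      simp only [← integral_const_mul]
      simp only [← integral_finsetSum _ fun k _ => hi _ k]
      rw [← integral_finsetSum _ fun j _ => integrable_finsetSum _ fun k _ => hi j k]
      have hpos := fun s => sum_mul_star_nonneg z (fun j => jump (t j) s)
      exact integral_nonneg hpos
  · have h := hdecomp 0 t
    simp only [zero_sub, h0, map_zero, inner_zero_left, Complex.ofReal_zero, sub_zero] at h
    have h2 : ∀ s : Vec L, jump 0 s = 0 := fun s => by simp [jump]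
    simp only [h2, zero_mul, integral_zero, add_zero] at h
    exact sub_eq_zero.mp h

end LevyCharacteristic

/-! ### The Lévy characteristic functional -/

section LevyFunctional

variable {d L : ℕ} {ψ : Vec L → ℂ}

theorem IsLevyExponent.continuous (hψ : IsLevyExponent ψ) : Continuous ψ := by
  obtain ⟨K, -, hK⟩ := hψ.lipschitz
  refine continuous_iff_continuousAt.mpr fun t => ?_
  rw [ContinuousAt, tendsto_iff_norm_sub_tendsto_zero]
  refine squeeze_zero (fun _ => norm_nonneg _) (fun s => hK s t) ?_
  have : Continuous fun s => K * ‖s - t‖ * (1 + ‖s‖ + ‖t‖) := by fun_prop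
  simpa using this.tendsto t

theorem IsLevyExponent.integrable_comp (hψ : IsLevyExponent ψ) (f : TestFn d L) :
    Integrable (fun x => ψ (f x)) := by
  obtain ⟨K, hK0, hK⟩ := hψ.lipschitz
  set b := ‖SchwartzMap.toBoundedContinuousFunction f‖
  refine (f.integrable.norm.mul_const (K * (1 + b))).mono'
    (hψ.continuous.comp f.continuous).aestronglyMeasurable (Eventually.of_forall fun x => ?_)
  have h1 := hK (f x) 0
  have h2 : ‖f x‖ ≤ b := (SchwartzMap.toBoundedContinuousFunction f).norm_coe_le_norm x
  simp only [hψ.map_zero, sub_zero, norm_zero, add_zero] at h1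
  calc ‖ψ (f x)‖ ≤ K * ‖f x‖ * (1 + ‖f x‖) := h1
    _ ≤ K * ‖f x‖ * (1 + b) := by gcongr
    _ = _ := by ring

/-- The Lipschitz bound is controlled by the supremum norm and the `L¹` norm of test functions. -/
theorem IsLevyExponent.continuous_integral (hψ : IsLevyExponent ψ) :
    Continuous fun f : TestFn d L => ∫ x, ψ (f x) := by
  obtain ⟨K, hK0, hK⟩ := hψ.lipschitz
  let b : TestFn d L → ℝ := fun f =>
    ‖SchwartzMap.toBoundedContinuousFunctionCLM ℝ (Vec d) (Vec L) f‖
  have hb : ∀ f x, ‖f x‖ ≤ b f := fun f x =>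
    (SchwartzMap.toBoundedContinuousFunction f).norm_coe_le_norm x
  let ℓ : TestFn d L → ℝ := fun f =>
    ‖SchwartzMap.toLpCLM ℝ (Vec L) 1 (volume : Measure (Vec d)) f‖
  have hℓ : ∀ f, ℓ f = ∫ x, ‖f x‖ := fun f => SchwartzMap.norm_toLp_one
  refine continuous_iff_continuousAt.mpr fun f => ?_
  rw [ContinuousAt, tendsto_iff_norm_sub_tendsto_zero]
  refine squeeze_zero (g := fun h => K * (1 + b h + b f) * ℓ (h - f)) (fun _ => norm_nonneg _)
    (fun h => ?_) ?_
  · rw [← integral_sub (hψ.integrable_comp h) (hψ.integrable_comp f), hℓ, ← integral_const_mul]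
    refine norm_integral_le_of_norm_le ((h - f).integrable.norm.const_mul _)
      (Eventually.of_forall fun x => (hK _ _).trans ?_)
    have h1 := hb h x
    have h2 := hb f x
    calc K * ‖h x - f x‖ * (1 + ‖h x‖ + ‖f x‖) ≤ K * ‖h x - f x‖ * (1 + b h + b f) := by gcongr
      _ = K * (1 + b h + b f) * ‖(h - f) x‖ := by rw [sub_apply]; ring
  · have : Continuous fun h => K * (1 + b h + b f) * ℓ (h - f) := by fun_prop
    have h0 : ℓ 0 = 0 := by rw [hℓ]; simp
    simpa [h0] using this.tendsto f

/-- The functional `f ↦ exp (∫ ψ ∘ f)` is a characteristic functional. -/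
theorem IsLevyExponent.isCharFunctional (hψ : IsLevyExponent ψ) :
    IsCharFunctional (levyFunctional (d := d) ψ) where
  continuous := Complex.continuous_exp.comp hψ.continuous_integral
  map_zero := by simp [levyFunctional, hψ.map_zero]
  posDef := by
    refine isPosDefFun_exp (B := fun f : TestFn d L => ∫ x, ψ (f x))
      (K := fun f h => (∫ x, ψ ((f - h) x)) - (∫ x, ψ (f x)) - star (∫ x, ψ (h x)))
      (a := fun f => ∫ x, ψ (f x)) (fun f h => by ring) fun n f => ?_
    have hstar : ∀ f : TestFn d L, star (∫ x, ψ (f x)) = ∫ x, star (ψ (f x)) := fun f =>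
      integral_conj.symm
    have hH : (Matrix.of fun j k => (∫ x, ψ ((f j - f k) x)) - (∫ x, ψ (f j x)) -
        star (∫ x, ψ (f k x))).IsHermitian := by
      ext j k
      have : star (∫ x, ψ ((f k - f j) x)) = ∫ x, ψ ((f j - f k) x) := by
        rw [hstar]
        congr 1 with x
        rw [← hψ.map_neg, sub_apply, sub_apply, neg_sub]
      simp only [Matrix.conjTranspose_apply, Matrix.of_apply, star_sub, star_star, this]
      ring
    rw [posSemidef_iff_sum_nonneg hH]
    intro z
    have hi1 := fun j => hψ.integrable_comp (f j)
    have hi2 := fun j k => hψ.integrable_comp (f j - f k)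
    have hi3 : ∀ k, Integrable fun x => star (ψ (f k x)) := fun k => integrable_star (hi1 k)
    have hi4 : ∀ j k, Integrable fun x => ψ ((f j - f k) x) - ψ (f j x) := fun j k =>
      (hi2 j k).sub (hi1 j)
    have hi : ∀ j k, Integrable fun x => z j * star (z k) *
        (ψ (f j x - f k x) - ψ (f j x) - star (ψ (f k x))) := fun j k =>
      ((hi4 j k).sub (hi3 k)).const_mul _
    have e : ∀ j k, z j * star (z k) * (Matrix.of fun j k => (∫ x, ψ ((f j - f k) x)) -
        (∫ x, ψ (f j x)) - star (∫ x, ψ (f k x))) j k =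
        ∫ x, z j * star (z k) * (ψ (f j x - f k x) - ψ (f j x) - star (ψ (f k x))) := by
      intro j k
      rw [Matrix.of_apply, hstar, ← integral_sub (hi2 j k) (hi1 j),
        ← integral_sub (hi4 j k) (hi3 k), ← integral_const_mul]
      rfl
    simp only [e]
    simp only [← integral_finsetSum _ fun k _ => hi _ k]
    rw [← integral_finsetSum _ fun j _ => integrable_finsetSum _ fun k _ => hi j k]
    have hpos := fun x => hψ.sum_nonneg n (fun j => f j x) z
    exact integral_nonneg hpos

end LevyFunctional

/-! ### Matrices acting on Euclidean space -/

section MatAct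

theorem matAct_apply {n : ℕ} (A : Matrix (Fin n) (Fin n) ℝ) (x : Vec n) (i : Fin n) :
    matAct A x i = ∑ j, A i j * x j := by
  simp [matAct, Matrix.mulVec, dotProduct]

theorem inner_matAct_conjTranspose_mul {n : ℕ} (A : Matrix (Fin n) (Fin n) ℝ) (v w : Vec n) :
    inner ℝ v (matAct (Aᴴ * A) w) = inner ℝ (matAct A v) (matAct A w) := by
  have h1 : matAct (Aᴴ * A) w = matAct Aᴴ (matAct A w) := by
    simp [matAct, map_mul]
  have h2 : matAct Aᴴ = ContinuousLinearMap.adjoint (matAct A) := by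
    rw [← ContinuousLinearMap.star_eq_adjoint, ← map_star]
    rfl
  rw [h1, h2, ContinuousLinearMap.adjoint_inner_right]

theorem inner_single_matAct_single {n : ℕ} (A : Matrix (Fin n) (Fin n) ℝ) (i j : Fin n) :
    inner ℝ (EuclideanSpace.single i 1) (matAct A (EuclideanSpace.single j 1)) = A i j := by
  simp [EuclideanSpace.inner_single_left]

theorem posSemidef_of_inner_nonneg {n : ℕ} {A : Matrix (Fin n) (Fin n) ℝ} (hA : A.IsHermitian)
    (h : ∀ v : Vec n, 0 ≤ inner ℝ v (matAct A v)) : A.PosSemidef := by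
  refine Matrix.PosSemidef.of_dotProduct_mulVec_nonneg hA fun x => ?_
  have := h (WithLp.toLp 2 x)
  simpa [PiLp.inner_apply, matAct_apply, dotProduct, Matrix.mulVec, mul_comm] using this

end MatAct

/-! ### Second derivatives of a Lévy characteristic at the origin -/

section Hessian

variable {L : ℕ}

theorem hasDerivAt_exp_I_mul (α β r : ℝ) :
    HasDerivAt (fun r : ℝ => Complex.exp (Complex.I * ((α + r * β : ℝ) : ℂ)))
      (Complex.I * (β : ℂ) * Complex.exp (Complex.I * ((α + r * β : ℝ) : ℂ))) r := by
  have h1 : HasDerivAt (fun r : ℝ => α + r * β) β r := by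
    simpa using ((hasDerivAt_id r).mul_const β).const_add α
  have h2 := (h1.ofReal_comp.const_mul Complex.I).cexp
  rw [mul_comm] at h2
  exact h2

theorem abs_inner_mul_inner_le (v w s : Vec L) :
    |inner ℝ v s * inner ℝ w s| ≤ ‖v‖ * ‖w‖ * ‖s‖ ^ 2 := by
  rw [abs_mul]
  calc |inner ℝ v s| * |inner ℝ w s| ≤ (‖v‖ * ‖s‖) * (‖w‖ * ‖s‖) :=
        mul_le_mul (abs_real_inner_le_norm _ _) (abs_real_inner_le_norm _ _) (abs_nonneg _)
          (by positivity)
    _ = _ := by ring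

variable {M : Measure (Vec L)}

theorem integrable_inner_mul_inner (hM : Integrable (fun s => ‖s‖ ^ 2) M) (v w : Vec L) :
    Integrable (fun s => inner ℝ v s * inner ℝ w s) M :=
  (hM.const_mul (‖v‖ * ‖w‖)).mono' (Continuous.aestronglyMeasurable (by fun_prop))
    (Eventually.of_forall fun s => abs_inner_mul_inner_le v w s)

/-- Differentiation of the jump integral under the integral sign, by the first moment of `M`. -/
theorem hasDerivAt_integral_jump (hM : Integrable (fun s => ‖s‖) M) (t w : Vec L) :
    HasDerivAt (fun r : ℝ => ∫ s, jump (t + r • w) s ∂M)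
      (∫ s, Complex.I * ((inner ℝ w s : ℝ) : ℂ) *
        Complex.exp (Complex.I * ((inner ℝ t s : ℝ) : ℂ)) ∂M) 0 := by
  have h := hasDerivAt_integral_of_dominated_loc_of_deriv_le (μ := M) (x₀ := (0 : ℝ))
    (F := fun r s => jump (t + r • w) s)
    (F' := fun r s => Complex.I * ((inner ℝ w s : ℝ) : ℂ) *
      Complex.exp (Complex.I * ((inner ℝ t s + r * inner ℝ w s : ℝ) : ℂ)))
    (bound := fun s => ‖w‖ * ‖s‖) univ_mem
    (Eventually.of_forall fun r => (continuous_jump _).aestronglyMeasurable)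
    (integrable_jump hM _) (Continuous.aestronglyMeasurable (by fun_prop))
    (Eventually.of_forall fun s r _ => ?_) (hM.const_mul _)
    (Eventually.of_forall fun s r _ => ?_)
  · simpa using h.2
  · rw [norm_mul, mul_comm Complex.I ((_ : ℝ) : ℂ), mul_comm Complex.I ((_ : ℝ) : ℂ),
      Complex.norm_exp_ofReal_mul_I, norm_mul, Complex.norm_I, Complex.norm_real, mul_one, mul_one]
    exact norm_inner_le_norm w s
  · simp only [jump, inner_add_left, inner_smul_left]
    exact (hasDerivAt_exp_I_mul _ _ r).sub_const 1

/-- Second differentiation of the jump integral, at the origin, by the second moment of `M`. -/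
theorem hasDerivAt_integral_inner_mul_exp (hM : Integrable (fun s => ‖s‖) M)
    (hM2 : Integrable (fun s => ‖s‖ ^ 2) M) (v w : Vec L) :
    HasDerivAt (fun r : ℝ => ∫ s, Complex.I * ((inner ℝ w s : ℝ) : ℂ) *
        Complex.exp (Complex.I * ((inner ℝ (0 + r • v) s : ℝ) : ℂ)) ∂M)
      (-((∫ s, inner ℝ v s * inner ℝ w s ∂M : ℝ) : ℂ)) 0 := by
  have h := hasDerivAt_integral_of_dominated_loc_of_deriv_le (μ := M) (x₀ := (0 : ℝ))
    (F := fun r s => Complex.I * ((inner ℝ w s : ℝ) : ℂ) *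
        Complex.exp (Complex.I * ((inner ℝ (0 + r • v) s : ℝ) : ℂ)))
    (F' := fun r s => Complex.I * ((inner ℝ w s : ℝ) : ℂ) * (Complex.I * ((inner ℝ v s : ℝ) : ℂ) *
      Complex.exp (Complex.I * ((0 + r * inner ℝ v s : ℝ) : ℂ))))
    (bound := fun s => ‖v‖ * ‖w‖ * ‖s‖ ^ 2) univ_mem
    (Eventually.of_forall fun r => Continuous.aestronglyMeasurable (by fun_prop))
    ((hM.const_mul ‖w‖).mono' (Continuous.aestronglyMeasurable (by fun_prop))
      (Eventually.of_forall fun s => ?_))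
    (Continuous.aestronglyMeasurable (by fun_prop))
    (Eventually.of_forall fun s r _ => ?_) (hM2.const_mul _)
    (Eventually.of_forall fun s r _ => ?_)
  · have h2 := h.2
    rw [← integral_complex_ofReal, ← integral_neg]
    refine h2.congr_deriv (integral_congr_ae (Eventually.of_forall fun s => ?_))
    simp only [zero_mul, add_zero, Complex.ofReal_zero, mul_zero, Complex.exp_zero, mul_one]
    push_cast
    linear_combination (((inner ℝ w s : ℝ) : ℂ) * ((inner ℝ v s : ℝ) : ℂ)) * Complex.I_mul_I
  · rw [norm_mul, mul_comm Complex.I ((_ : ℝ) : ℂ), mul_comm Complex.I ((_ : ℝ) : ℂ),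
      Complex.norm_exp_ofReal_mul_I, norm_mul, Complex.norm_I, Complex.norm_real, mul_one, mul_one]
    exact norm_inner_le_norm w s
  · have e := abs_inner_mul_inner_le v w s
    rw [norm_mul, norm_mul, norm_mul, norm_mul, mul_comm Complex.I ((0 + _ : ℝ) : ℂ),
      Complex.norm_exp_ofReal_mul_I, Complex.norm_I, Complex.norm_real, Complex.norm_real, one_mul,
      one_mul, mul_one, mul_comm, ← norm_mul]
    exact e
  · have e : ∀ r : ℝ, inner ℝ (0 + r • v) s = 0 + r * inner ℝ v s := fun r => by
      simp [inner_smul_left]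
    simp only [e]
    exact (hasDerivAt_exp_I_mul _ _ r).const_mul _

/-- The second derivative at the origin of a smooth Lévy characteristic is minus a positive
semidefinite form, the sum of the Gaussian covariance and of the second moments of the
Lévy measure. -/
theorem IsSmoothLevyCharacteristic.exists_covariance {ψ : Vec L → ℂ}
    (hψ : IsSmoothLevyCharacteristic ψ) :
    ∃ N : Matrix (Fin L) (Fin L) ℝ, N.PosSemidef ∧ ∀ v w : Vec L,
      lineDeriv ℝ (fun t => lineDeriv ℝ ψ t w) 0 v = -((inner ℝ v (matAct N w) : ℝ) : ℂ) := by
  obtain ⟨a, σ, M, -, -, hM, hψ⟩ := hψ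
  have hM1 : Integrable (fun s => ‖s‖) M := integrable_norm_of_moments hM
  have hM2 := hM 2 (by norm_num)
  let N₁ : Matrix (Fin L) (Fin L) ℝ := Matrix.of fun i j => ∫ s, s i * s j ∂M
  have hint : ∀ i j : Fin L, Integrable (fun s : Vec L => s i * s j) M := fun i j => by
    simpa [EuclideanSpace.inner_single_left] using
      integrable_inner_mul_inner hM2 (EuclideanSpace.single i 1) (EuclideanSpace.single j 1)
  have hN₁ : ∀ v w : Vec L,
      inner ℝ v (matAct N₁ w) = ∫ s, inner ℝ v s * inner ℝ w s ∂M := by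
    intro v w
    have e : ∀ s : Vec L, inner ℝ v s * inner ℝ w s = ∑ i, ∑ j, v i * w j * (s i * s j) := by
      intro s
      rw [PiLp.inner_apply, PiLp.inner_apply, Finset.sum_mul_sum]
      refine Finset.sum_congr rfl fun i _ => Finset.sum_congr rfl fun j _ => ?_
      simp only [RCLike.inner_apply, conj_trivial]
      ring
    simp only [e]
    rw [integral_finsetSum _ fun i _ => integrable_finsetSum _ fun j _ => (hint i j).const_mul _,
      PiLp.inner_apply]
    refine Finset.sum_congr rfl fun i _ => ?_
    rw [integral_finsetSum _ fun j _ => (hint i j).const_mul _, matAct_apply]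
    simp only [RCLike.inner_apply, conj_trivial, Finset.sum_mul, integral_const_mul, N₁,
      Matrix.of_apply]
    exact Finset.sum_congr rfl fun j _ => by ring
  have hN₁p : N₁.PosSemidef := by
    refine posSemidef_of_inner_nonneg ?_ fun v => ?_
    · ext i j
      simp [N₁, mul_comm]
    · rw [hN₁]
      exact integral_nonneg fun s => mul_self_nonneg _
  refine ⟨σᴴ * σ + N₁, (Matrix.posSemidef_conjTranspose_mul_self σ).add hN₁p, fun v w => ?_⟩
  have hψ' : ∀ t, ψ t = Complex.I * ((inner ℝ a t : ℝ) : ℂ)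
      - ((inner ℝ (matAct σ t) (matAct σ t) : ℝ) : ℂ) / 2 + ∫ s, jump t s ∂M := hψ
  have h1 : ∀ t, lineDeriv ℝ ψ t w = Complex.I * ((inner ℝ a w : ℝ) : ℂ) -
      ((inner ℝ (matAct σ t) (matAct σ w) : ℝ) : ℂ) +
      ∫ s, Complex.I * ((inner ℝ w s : ℝ) : ℂ) *
        Complex.exp (Complex.I * ((inner ℝ t s : ℝ) : ℂ)) ∂M := by
    intro t
    refine HasDerivAt.deriv ?_
    simp only [hψ']
    refine HasDerivAt.add (HasDerivAt.sub ?_ ?_) (hasDerivAt_integral_jump hM1 t w)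
    · have e : ∀ r : ℝ, inner ℝ a (t + r • w) = inner ℝ a t + r * inner ℝ a w := fun r => by
        rw [inner_add_right, inner_smul_right]
      simp only [e]
      have : HasDerivAt (fun r : ℝ => inner ℝ a t + r * inner ℝ a w) (inner ℝ a w) 0 := by
        simpa using ((hasDerivAt_id (0 : ℝ)).mul_const (inner ℝ a w)).const_add (inner ℝ a t)
      exact this.ofReal_comp.const_mul _
    · have e : ∀ r : ℝ, inner ℝ (matAct σ (t + r • w)) (matAct σ (t + r • w)) =
          inner ℝ (matAct σ t) (matAct σ t) + (2 * r) * inner ℝ (matAct σ t) (matAct σ w) +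
            r ^ 2 * inner ℝ (matAct σ w) (matAct σ w) := fun r => by
        rw [map_add, map_smul, real_inner_add_add_self, inner_smul_left, inner_smul_right,
          inner_smul_right]
        simp only [conj_trivial]
        ring
      simp only [e]
      have : HasDerivAt (fun r : ℝ => inner ℝ (matAct σ t) (matAct σ t) +
          (2 * r) * inner ℝ (matAct σ t) (matAct σ w) +
            r ^ 2 * inner ℝ (matAct σ w) (matAct σ w))
          (2 * inner ℝ (matAct σ t) (matAct σ w)) 0 := by
        have h1 := ((((hasDerivAt_id (0 : ℝ)).const_mul 2).mul_const
          (inner ℝ (matAct σ t) (matAct σ w))).const_add (inner ℝ (matAct σ t) (matAct σ t))).add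
          ((hasDerivAt_pow 2 (0 : ℝ)).mul_const (inner ℝ (matAct σ w) (matAct σ w)))
        refine (h1.congr_of_eventuallyEq (Eventually.of_forall fun r => ?_)).congr_deriv ?_
        · simp
        · simp
      have h2 := this.ofReal_comp.div_const 2
      simpa using h2
  simp only [h1]
  refine HasDerivAt.deriv ?_
  have h2 := hasDerivAt_integral_inner_mul_exp hM1 hM2 v w
  have e : ∀ r : ℝ, inner ℝ (matAct σ (0 + r • v)) (matAct σ w) =
      r * inner ℝ (matAct σ v) (matAct σ w) := fun r => by
    rw [zero_add, map_smul, inner_smul_left]; simp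
  have h3 : HasDerivAt (fun r : ℝ => Complex.I * ((inner ℝ a w : ℝ) : ℂ) -
      ((inner ℝ (matAct σ (0 + r • v)) (matAct σ w) : ℝ) : ℂ))
      (-((inner ℝ (matAct σ v) (matAct σ w) : ℝ) : ℂ)) 0 := by
    simp only [e]
    have : HasDerivAt (fun r : ℝ => r * inner ℝ (matAct σ v) (matAct σ w))
        (inner ℝ (matAct σ v) (matAct σ w)) 0 := by
      simpa using (hasDerivAt_id (0 : ℝ)).mul_const (inner ℝ (matAct σ v) (matAct σ w))
    exact this.ofReal_comp.const_sub _
  have h4 := h3.add h2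
  convert! h4 using 1
  rw [← hN₁, ← inner_matAct_conjTranspose_mul]
  simp only [matAct, map_add, add_apply, inner_add_right]
  push_cast
  ring

/-- `IsSigmaBar ψ S` says that `S` is the positive semidefinite square root of the covariance. -/
theorem isSigmaBar_iff {ψ : Vec L → ℂ} {N : Matrix (Fin L) (Fin L) ℝ}
    (hN : ∀ v w : Vec L,
      lineDeriv ℝ (fun t => lineDeriv ℝ ψ t w) 0 v = -((inner ℝ v (matAct N w) : ℝ) : ℂ))
    (S : Matrix (Fin L) (Fin L) ℝ) : IsSigmaBar ψ S ↔ S.PosSemidef ∧ S * S = N := by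
  have e : -hessianAtZero ψ = N.map (fun r => (r : ℂ)) := by
    ext i j
    simp only [hessianAtZero, Matrix.neg_apply, Matrix.of_apply, hN, neg_neg, Matrix.map_apply,
      inner_single_matAct_single]
  rw [IsSigmaBar, e]
  exact and_congr_right fun _ =>
    (Matrix.map_injective (f := fun r : ℝ => (r : ℂ)) Complex.ofReal_injective).eq_iff

open scoped MatrixOrder in
theorem IsSmoothLevyCharacteristic.existsUnique_sigmaBar {ψ : Vec L → ℂ}
    (hψ : IsSmoothLevyCharacteristic ψ) : ∃! S : Matrix (Fin L) (Fin L) ℝ, IsSigmaBar ψ S := by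
  obtain ⟨N, hN, hNψ⟩ := hψ.exists_covariance
  simp only [isSigmaBar_iff hNψ]
  refine ⟨CFC.sqrt N, ⟨Matrix.nonneg_iff_posSemidef.mp (CFC.sqrt_nonneg N),
    CFC.sqrt_mul_sqrt_self N hN.nonneg⟩, ?_⟩
  rintro S ⟨hS, hSN⟩
  exact (CFC.sqrt_unique hSN hS.nonneg).symm

theorem IsSmoothLevyCharacteristic.lineDeriv_lineDeriv_eq {ψ : Vec L → ℂ}
    (hψ : IsSmoothLevyCharacteristic ψ) {S : Matrix (Fin L) (Fin L) ℝ} (hS : IsSigmaBar ψ S)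
    (v w : Vec L) : lineDeriv ℝ (fun t => lineDeriv ℝ ψ t w) 0 v =
      -((inner ℝ (matAct S v) (matAct S w) : ℝ) : ℂ) := by
  obtain ⟨N, hN, hNψ⟩ := hψ.exists_covariance
  rw [isSigmaBar_iff hNψ] at hS
  rw [hNψ, ← hS.2, ← inner_matAct_conjTranspose_mul, hS.1.1]

/-- The form `⟪S v, S w⟫` inherits the symmetries of `ψ`. -/
theorem IsSmoothLevyCharacteristic.inner_matAct_sigmaBar {ψ : Vec L → ℂ}
    (hψ : IsSmoothLevyCharacteristic ψ) {S : Matrix (Fin L) (Fin L) ℝ} (hS : IsSigmaBar ψ S)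
    {A : Vec L →L[ℝ] Vec L} (hA : ∀ t, ψ (A t) = ψ t) (v w : Vec L) :
    inner ℝ (matAct S (A v)) (matAct S (A w)) = inner ℝ (matAct S v) (matAct S w) := by
  have h1 : ∀ t, lineDeriv ℝ ψ (A t) (A w) = lineDeriv ℝ ψ t w := by
    intro t
    simp only [lineDeriv, ← map_smul, ← map_add, hA]
  have h2 : lineDeriv ℝ (fun t => lineDeriv ℝ ψ t (A w)) 0 (A v) =
      lineDeriv ℝ (fun t => lineDeriv ℝ ψ t w) 0 v := by
    have h3 : ∀ r : ℝ, 0 + r • A v = A (0 + r • v) := fun r => by simp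
    change deriv (fun r : ℝ => lineDeriv ℝ ψ (0 + r • A v) (A w)) 0 = _
    simp only [h3, h1]
    rfl
  rw [hψ.lineDeriv_lineDeriv_eq hS, hψ.lineDeriv_lineDeriv_eq hS] at h2
  exact_mod_cast neg_injective h2

end Hessian

/-! ### Polynomials of the Laplacian -/

section PolyNegLaplacian

open Laplacian LineDeriv FourierTransform SchwartzMap

variable {d L : ℕ}

theorem polyNegLaplacian_C (c : ℝ) (f : TestFn d L) :
    polyNegLaplacian d L (Polynomial.C c) f = c • f := by
  simp [polyNegLaplacian, Algebra.algebraMap_eq_smul_one]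

theorem polyNegLaplacian_add (p q : Polynomial ℝ) (f : TestFn d L) :
    polyNegLaplacian d L (p + q) f = polyNegLaplacian d L p f + polyNegLaplacian d L q f := by
  simp [polyNegLaplacian]

theorem polyNegLaplacian_X_mul (p : Polynomial ℝ) (f : TestFn d L) :
    polyNegLaplacian d L (Polynomial.X * p) f = -Δ (polyNegLaplacian d L p f) := by
  rw [polyNegLaplacian, map_mul, Polynomial.aeval_X, mul_apply_eq_comp, neg_apply, laplacianCLM_eq']
  rfl

/-- Induction on the polynomial, by Horner's scheme. -/
theorem polynomial_induction_X_mul {motive : Polynomial ℝ → Prop}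
    (C : ∀ c, motive (Polynomial.C c)) (add : ∀ p q, motive p → motive q → motive (p + q))
    (X_mul : ∀ p, motive p → motive (Polynomial.X * p)) (p : Polynomial ℝ) : motive p := by
  refine Polynomial.induction_on p C add fun n a h => ?_
  rw [pow_succ', mul_left_comm]
  exact X_mul _ h

/-- An operator that commutes with the Laplacian commutes with every polynomial of it. -/
theorem polyNegLaplacian_comm {T : TestFn d L →L[ℝ] TestFn d L}
    (hT : ∀ f, Δ (T f) = T (Δ f)) (p : Polynomial ℝ) (f : TestFn d L) :
    polyNegLaplacian d L p (T f) = T (polyNegLaplacian d L p f) := by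
  induction p using polynomial_induction_X_mul with
  | C c => simp [polyNegLaplacian_C]
  | add p q hp hq => simp [polyNegLaplacian_add, hp, hq]
  | X_mul p hp => rw [polyNegLaplacian_X_mul, polyNegLaplacian_X_mul, hp, hT, map_neg]

/-- Polynomials of the Laplacian are local operators. -/
theorem polyNegLaplacian_apply_eq_zero (p : Polynomial ℝ) (f : TestFn d L) {x : Vec d}
    (hx : x ∉ tsupport f) : polyNegLaplacian d L p f x = 0 := by
  suffices h : x ∉ tsupport (polyNegLaplacian d L p f) from image_eq_zero_of_notMem_tsupport h
  rw [notMem_tsupport_iff_eventuallyEq] at hx ⊢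
  induction p using polynomial_induction_X_mul with
  | C c =>
    filter_upwards [hx] with y hy
    simp [polyNegLaplacian_C, hy]
  | add p q hp hq =>
    filter_upwards [hp, hq] with y hp hq
    simp [polyNegLaplacian_add, hp, hq]
  | X_mul p hp =>
    let b := stdOrthonormalBasis ℝ (Vec d)
    have h : ∀ i, ∀ᶠ y in 𝓝 x, ∂_{b i} (∂_{b i} (polyNegLaplacian d L p f)) y = 0 := by
      intro i
      rw [← notMem_tsupport_iff_eventuallyEq] at hp
      exact notMem_tsupport_iff_eventuallyEq.mp fun hxi => hp
        (tsupport_lineDerivOp_subset (b i) _ (tsupport_lineDerivOp_subset (b i) _ hxi))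
    filter_upwards [eventually_all.mpr h] with y hy
    rw [polyNegLaplacian_X_mul, laplacian_eq_sum b, neg_apply, _root_.sum_apply,
      Finset.sum_eq_zero fun i _ => hy i]
    simp

theorem lineDerivOp_translate (a m : Vec d) (f : TestFn d L) :
    ∂_{m} (translate a f) = translate a (∂_{m} f) := by
  ext x i
  simp only [translate, lineDerivOp_apply_eq_fderiv, compSubConstCLM_apply]
  have : (compSubConstCLM ℝ a f : Vec d → Vec L) = fun x => f (x - a) := by ext; simp
  rw [this, fderiv_comp_sub]

theorem polyNegLaplacian_translate (p : Polynomial ℝ) (a : Vec d) (f : TestFn d L) :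
    polyNegLaplacian d L p (translate a f) = translate a (polyNegLaplacian d L p f) := by
  refine polyNegLaplacian_comm (fun f => ?_) p f
  change Δ (translate a f) = translate a (Δ f)
  simp only [laplacian_eq_sum (stdOrthonormalBasis ℝ (Vec d)), lineDerivOp_translate]
  simp [translate]

theorem lineDerivOp_postcomp {F G : Type*} [NormedAddCommGroup F] [NormedSpace ℝ F]
    [NormedAddCommGroup G] [NormedSpace ℝ G] (A : F →L[ℝ] G) (m : Vec d)
    (f : SchwartzMap (Vec d) F) : ∂_{m} (postcompCLM A f) = postcompCLM A (∂_{m} f) := by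
  ext x
  simp only [lineDerivOp_apply_eq_fderiv, postcompCLM_apply]
  have : (postcompCLM A f : Vec d → G) = fun x => A (f x) := by ext; simp
  rw [this, fderiv_fun_comp x A.differentiableAt f.differentiableAt]
  simp

theorem laplacian_postcomp {F G : Type*} [NormedAddCommGroup F] [NormedSpace ℝ F]
    [NormedAddCommGroup G] [NormedSpace ℝ G] (A : F →L[ℝ] G)
    (f : SchwartzMap (Vec d) F) : Δ (postcompCLM A f) = postcompCLM A (Δ f) := by
  simp only [laplacian_eq_sum (stdOrthonormalBasis ℝ (Vec d)), lineDerivOp_postcomp, map_sum]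

theorem inner_rotation (g : SO d) (x y : Vec d) :
    inner ℝ (rotation g x) (rotation g y) = inner ℝ x y := by
  have h : (g : Matrix (Fin d) (Fin d) ℝ)ᴴ * g = 1 :=
    (Matrix.mem_unitaryGroup_iff').mp (Matrix.mem_specialOrthogonalGroup_iff.mp g.2).1
  change inner ℝ (matAct (g : Matrix (Fin d) (Fin d) ℝ) x) (matAct _ y) = _
  rw [← inner_matAct_conjTranspose_mul, h]
  simp

/-- The action of `SO(d)` on `ℝᵈ` by isometries. -/
noncomputable def rotationIsometry (g : SO d) : Vec d ≃ₗᵢ[ℝ] Vec d :=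
  (rotation g).toLinearEquiv.isometryOfInner (inner_rotation g)

theorem integral_comp_rotation {E : Type*} [NormedAddCommGroup E] [NormedSpace ℝ E]
    (g : SO d) (φ : Vec d → E) : ∫ x, φ (rotation g x) = ∫ x, φ x :=
  (rotationIsometry g).measurePreserving.integral_comp
    (rotationIsometry g).toHomeomorph.measurableEmbedding φ

/-- The Laplacian is computed in the orthonormal basis rotated by `g⁻¹`. -/
theorem laplacian_rotate (τ : SO d →* GL (Fin L) ℝ) (g : SO d) (f : TestFn d L) :
    Δ (rotate τ g f) = rotate τ g (Δ f) := by
  let b := stdOrthonormalBasis ℝ (Vec d)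
  have h : ∀ i, rotation g⁻¹ (b i) = b.map (rotationIsometry g⁻¹) i := fun i => by
    rw [OrthonormalBasis.map_apply]; rfl
  rw [rotate, rotate, laplacian_postcomp, laplacian_eq_sum b,
    laplacian_eq_sum (b.map (rotationIsometry g⁻¹)) f]
  simp only [lineDerivOp_compCLMOfContinuousLinearEquiv, h, map_sum]

theorem polyNegLaplacian_rotate (p : Polynomial ℝ) (τ : SO d →* GL (Fin L) ℝ) (g : SO d)
    (f : TestFn d L) :
    polyNegLaplacian d L p (rotate τ g f) = rotate τ g (polyNegLaplacian d L p f) :=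
  polyNegLaplacian_comm (T := postcompCLM (matAct (τ g : Matrix (Fin L) (Fin L) ℝ)) ∘L
    compCLMOfContinuousLinearEquiv ℝ (rotation g⁻¹)) (laplacian_rotate τ g) p f

theorem fourier_laplacian_apply {H : Type*} [NormedAddCommGroup H] [NormedSpace ℂ H]
    [CompleteSpace H] (u : SchwartzMap (Vec d) H) (ξ : Vec d) :
    𝓕 (Δ u) ξ = -((2 * Real.pi * ‖ξ‖) ^ 2 : ℝ) • 𝓕 u ξ := by
  rw [laplacian_eq_fourierMultiplierCLM, fourierMultiplierCLM_apply, fourier_smul,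
    fourier_fourierInv_eq, smul_apply, smulLeftCLM_apply_apply (by fun_prop), smul_smul]
  congr 1
  ring

/-- On the Fourier side `p(-Δ)` is multiplication by `p((2π|ξ|)²)`, also after mapping the values
linearly into a complex vector space. -/
theorem fourier_postcomp_polyNegLaplacian {H : Type*} [NormedAddCommGroup H] [NormedSpace ℂ H]
    [CompleteSpace H] (A : Vec L →L[ℝ] H) (p : Polynomial ℝ) (f : TestFn d L) (ξ : Vec d) :
    𝓕 (postcompCLM A (polyNegLaplacian d L p f)) ξ =
      p.eval ((2 * Real.pi * ‖ξ‖) ^ 2) • 𝓕 (postcompCLM A f) ξ := by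
  induction p using polynomial_induction_X_mul with
  | C c => simp [polyNegLaplacian_C]
  | add p q hp hq =>
    simp [polyNegLaplacian_add, add_smul, hp, hq]
  | X_mul p hp =>
    rw [polyNegLaplacian_X_mul, map_neg, ← laplacian_postcomp, ← neg_one_smul ℝ, fourier_smul,
      neg_one_smul, neg_apply, fourier_laplacian_apply, hp, neg_smul, neg_neg, smul_smul,
      Polynomial.eval_mul, Polynomial.eval_X]

end PolyNegLaplacian

/-! ### The Gaussian characteristic functional -/

section GaussianForm

open FourierTransform SchwartzMap

variable {d L : ℕ}

/-- The inclusion of `ℝᴸ` into `ℂᴸ`. -/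
noncomputable def complexify (L : ℕ) : Vec L →L[ℝ] EuclideanSpace ℂ (Fin L) :=
  LinearMap.toContinuousLinearMap
    { toFun := fun v => WithLp.toLp 2 fun i => (v i : ℂ)
      map_add' := fun v w => by ext i; simp
      map_smul' := fun c v => by ext i; simp }

theorem inner_complexify (v w : Vec L) :
    inner ℂ (complexify L v) (complexify L w) = ((inner ℝ v w : ℝ) : ℂ) := by
  simp [complexify, PiLp.inner_apply]

/-- A Fourier multiplier with nonnegative symbol `m` is a nonnegative operator. -/
theorem integral_inner_multiplier_nonneg {H : Type*} [NormedAddCommGroup H] [InnerProductSpace ℂ H]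
    [CompleteSpace H] {m : Vec d → ℝ} (hm : ∀ ξ, 0 ≤ m ξ) {u w : SchwartzMap (Vec d) H}
    (huw : ∀ ξ, 𝓕 w ξ = m ξ • 𝓕 u ξ) : 0 ≤ ∫ x, inner ℂ (u x) (w x) := by
  rw [← integral_inner_fourier_fourier]
  refine integral_nonneg fun ξ => ?_
  change (0 : ℂ) ≤ _
  rw [huw, RCLike.real_smul_eq_coe_smul (K := ℂ), inner_smul_right, inner_self_eq_norm_sq_to_K,
    ← RCLike.ofReal_pow]
  refine mul_nonneg (by simpa using hm ξ) ?_
  exact RCLike.ofReal_nonneg.mpr (sq_nonneg ‖𝓕 u ξ‖)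

/-- A Fourier multiplier with real symbol `m` is a symmetric operator. -/
theorem integral_inner_multiplier_comm {H : Type*} [NormedAddCommGroup H] [InnerProductSpace ℂ H]
    [CompleteSpace H] {m : Vec d → ℝ} {u w u' w' : SchwartzMap (Vec d) H}
    (huw : ∀ ξ, 𝓕 w ξ = m ξ • 𝓕 u ξ) (huw' : ∀ ξ, 𝓕 w' ξ = m ξ • 𝓕 u' ξ) :
    ∫ x, inner ℂ (w x) (u' x) = ∫ x, inner ℂ (u x) (w' x) := by
  rw [← integral_inner_fourier_fourier, ← integral_inner_fourier_fourier u]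
  refine integral_congr_ae (Eventually.of_forall fun ξ => ?_)
  simp only [huw, huw', RCLike.real_smul_eq_coe_smul (K := ℂ), inner_smul_right, inner_smul_left,
    RCLike.conj_ofReal]

/-- The function `S f`, with values seen in `ℂᴸ`. -/
noncomputable def complexAct (S : Matrix (Fin L) (Fin L) ℝ) :
    TestFn d L →L[ℝ] SchwartzMap (Vec d) (EuclideanSpace ℂ (Fin L)) :=
  postcompCLM (complexify L ∘L matAct S)

/-- The covariance form `(f, h) ↦ ∫ S f · S p(-Δ)h dx`, written as an inner product in the complex
space `L²(ℝᵈ, ℂᴸ)`, on which the Fourier transform acts unitarily. -/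
noncomputable def gaussForm (S : Matrix (Fin L) (Fin L) ℝ) (p : Polynomial ℝ)
    (f h : TestFn d L) : ℂ :=
  inner ℂ (toLpCLM ℝ _ 2 volume (complexAct S f))
    (toLpCLM ℝ _ 2 volume (complexAct S (polyNegLaplacian d L p h)))

variable {S : Matrix (Fin L) (Fin L) ℝ} {p : Polynomial ℝ}

theorem gaussForm_eq (f h : TestFn d L) : gaussForm S p f h =
    ((∫ x, inner ℝ (matAct S (f x)) (matAct S (polyNegLaplacian d L p h x)) : ℝ) : ℂ) := by
  rw [gaussForm, toLpCLM_apply, toLpCLM_apply, inner_toL2_toL2_eq _ _ volume,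
    ← integral_complex_ofReal]
  simp only [complexAct, postcompCLM_apply, ContinuousLinearMap.comp_apply, inner_complexify]

theorem integrable_gaussIntegrand (f : TestFn d L) : Integrable (gaussIntegrand S p f) := by
  have h := (pairing (innerSL ℝ) (postcompCLM (matAct S) f)
    (postcompCLM (matAct S) (polyNegLaplacian d L p f))).integrable (μ := volume)
  refine h.congr (Eventually.of_forall fun x => ?_)
  simp only [pairing_apply_apply, postcompCLM_apply]
  rfl

theorem gaussFunctional_eq (f : TestFn d L) :
    gaussFunctional S p f = Complex.exp (-gaussForm S p f f) := by
  rw [gaussForm_eq]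
  rfl

theorem gaussForm_sub_left (f g h : TestFn d L) :
    gaussForm S p (f - g) h = gaussForm S p f h - gaussForm S p g h := by
  simp only [gaussForm, map_sub, inner_sub_left]

theorem gaussForm_sub_right (f g h : TestFn d L) :
    gaussForm S p f (g - h) = gaussForm S p f g - gaussForm S p f h := by
  simp only [gaussForm, map_sub, inner_sub_right]

theorem fourier_complexAct_polyNegLaplacian (f : TestFn d L) (ξ : Vec d) :
    𝓕 (complexAct S (polyNegLaplacian d L p f)) ξ =
      p.eval ((2 * Real.pi * ‖ξ‖) ^ 2) • 𝓕 (complexAct S f) ξ :=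
  fourier_postcomp_polyNegLaplacian _ p f ξ

theorem star_gaussForm (f h : TestFn d L) : star (gaussForm S p f h) = gaussForm S p h f := by
  rw [gaussForm, gaussForm, Complex.star_def, inner_conj_symm, toLpCLM_apply, toLpCLM_apply,
    inner_toL2_toL2_eq _ _ volume, toLpCLM_apply, toLpCLM_apply, inner_toL2_toL2_eq _ _ volume]
  exact integral_inner_multiplier_comm (fourier_complexAct_polyNegLaplacian h)
    (fourier_complexAct_polyNegLaplacian f)

/-- The form is Hermitian and, on real test functions, real, hence symmetric. -/
theorem gaussForm_comm (f h : TestFn d L) : gaussForm S p f h = gaussForm S p h f := by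
  rw [← star_gaussForm, gaussForm_eq, Complex.star_def, Complex.conj_ofReal]

/-- By sesquilinearity the sum is a single inner product `⟪u, p(-Δ)u⟫` with `u = ∑ z̄ⱼ S fⱼ`. -/
theorem sum_gaussForm_nonneg (hp : ∀ t : ℝ, 0 ≤ t → 0 ≤ p.eval t) {n : ℕ}
    (f : Fin n → TestFn d L) (z : Fin n → ℂ) :
    0 ≤ ∑ j, ∑ k, z j * star (z k) * gaussForm S p (f j) (f k) := by
  let T := toLpCLM ℂ (EuclideanSpace ℂ (Fin L)) 2 (volume : Measure (Vec d))
  have e : ∑ j, ∑ k, z j * star (z k) * gaussForm S p (f j) (f k) =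
      inner ℂ (T (∑ j, star (z j) • complexAct S (f j)))
        (T (∑ k, star (z k) • complexAct S (polyNegLaplacian d L p (f k)))) := by
    rw [map_sum, map_sum, sum_inner]
    refine Finset.sum_congr rfl fun j _ => ?_
    rw [inner_sum]
    refine Finset.sum_congr rfl fun k _ => ?_
    rw [map_smul, map_smul, inner_smul_left, inner_smul_right, ← mul_assoc, Complex.star_def,
      Complex.conj_conj]
    rfl
  rw [e, toLpCLM_apply, toLpCLM_apply, inner_toL2_toL2_eq _ _ volume]
  refine integral_inner_multiplier_nonneg (m := fun ξ => p.eval ((2 * Real.pi * ‖ξ‖) ^ 2))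
    (fun ξ => hp _ (sq_nonneg _)) fun ξ => ?_
  have e : ∀ v : Fin n → SchwartzMap (Vec d) (EuclideanSpace ℂ (Fin L)),
      𝓕 (∑ j, star (z j) • v j) ξ = ∑ j, star (z j) • 𝓕 (v j) ξ := fun v => by
    rw [← fourierTransformCLM_apply (𝕜 := ℂ), map_sum]
    simp [_root_.sum_apply]
  simp only [e, fourier_complexAct_polyNegLaplacian, Finset.smul_sum]
  exact Finset.sum_congr rfl fun j _ => smul_comm _ _ _

theorem integral_gaussIntegrand_nonneg (hp : ∀ t : ℝ, 0 ≤ t → 0 ≤ p.eval t) (f : TestFn d L) :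
    0 ≤ ∫ x, gaussIntegrand S p f x := by
  have h := sum_gaussForm_nonneg (S := S) hp (fun _ : Fin 1 => f) (fun _ => 1)
  simp only [Finset.univ_unique, Finset.sum_singleton, star_one, one_mul, gaussForm_eq] at h
  exact_mod_cast h

/-- The functional `exp(-Q)` of a positive semidefinite quadratic form `Q` is positive definite:
up to a factor depending on each variable alone, `exp(-Q(f - h))` is the exponential of the
positive semidefinite kernel `2 Q(f, h)`. -/
theorem isCharFunctional_gaussFunctional (hp : ∀ t : ℝ, 0 ≤ t → 0 ≤ p.eval t) :
    IsCharFunctional (gaussFunctional (d := d) S p) where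
  continuous := by
    have h : gaussFunctional (d := d) S p = fun f => Complex.exp (-gaussForm S p f f) :=
      funext gaussFunctional_eq
    rw [h]
    simp only [gaussForm]
    fun_prop
  map_zero := by simp [gaussFunctional, gaussIntegrand]
  posDef := by
    have h : gaussFunctional (d := d) S p = fun f => Complex.exp (-gaussForm S p f f) :=
      funext gaussFunctional_eq
    rw [h]
    refine isPosDefFun_exp (B := fun f => -gaussForm S p f f)
      (K := fun f h => 2 * gaussForm S p f h) (a := fun f => -gaussForm S p f f)
      (fun f h => ?_) fun n f => ?_
    · rw [star_neg, star_gaussForm, gaussForm_sub_left, gaussForm_sub_right, gaussForm_sub_right,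
        gaussForm_comm h f]
      ring
    · rw [posSemidef_iff_sum_nonneg]
      · intro z
        have h2 := mul_nonneg zero_le_two (sum_gaussForm_nonneg (S := S) hp f z)
        simp only [Finset.mul_sum] at h2
        refine h2.trans_eq
          (Finset.sum_congr rfl fun j _ => Finset.sum_congr rfl fun k _ => ?_)
        rw [Matrix.of_apply]
        ring
      · ext j k
        simp only [Matrix.conjTranspose_apply, Matrix.of_apply, star_mul', star_gaussForm]
        simp

end GaussianForm

/-! ### Rotations, translations and locality -/

section Symmetries

variable {d L : ℕ}

theorem rotate_smul (τ : SO d →* GL (Fin L) ℝ) (g : SO d) (c : ℝ) (f : TestFn d L) :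
    rotate τ g (c • f) = c • rotate τ g f := by
  simp [rotate]

theorem translate_smul (a : Vec d) (c : ℝ) (f : TestFn d L) :
    translate a (c • f) = c • translate a f := by
  simp [translate]

variable {ψ : Vec L → ℂ} {τ : SO d →* GL (Fin L) ℝ}

theorem levyFunctional_rotate (hinv : IsInvariant τ ψ) (g : SO d) (f : TestFn d L) :
    levyFunctional ψ (rotate τ g f) = levyFunctional ψ f := by
  have h := integral_comp_rotation g⁻¹ fun x => ψ (f x)
  simp only [levyFunctional, rotate_apply, hinv g]
  exact congrArg Complex.exp h

theorem levyFunctional_translate (a : Vec d) (f : TestFn d L) :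
    levyFunctional ψ (translate a f) = levyFunctional ψ f := by
  simp only [levyFunctional, translate_apply]
  rw [integral_sub_right_eq_self fun x => ψ (f x)]

theorem IsLevyExponent.levyFunctional_add (hψ : IsLevyExponent ψ) {f h : TestFn d L}
    (hfh : Disjoint (tsupport f) (tsupport h)) (s t : ℝ) :
    levyFunctional ψ (s • f + t • h) = levyFunctional ψ (s • f) * levyFunctional ψ (t • h) := by
  rw [levyFunctional, levyFunctional, levyFunctional, ← Complex.exp_add,
    ← integral_add (hψ.integrable_comp _) (hψ.integrable_comp _)]
  congr 2 with x
  by_cases hx : x ∈ tsupport f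
  · have := image_eq_zero_of_notMem_tsupport (Set.disjoint_left.mp hfh hx)
    simp [this, hψ.map_zero]
  · have := image_eq_zero_of_notMem_tsupport hx
    simp [this, hψ.map_zero]

variable {S : Matrix (Fin L) (Fin L) ℝ} {p : Polynomial ℝ}

theorem gaussFunctional_rotate (hψ : IsSmoothLevyCharacteristic ψ) (hinv : IsInvariant τ ψ)
    (hS : IsSigmaBar ψ S) (g : SO d) (f : TestFn d L) :
    gaussFunctional S p (rotate τ g f) = gaussFunctional S p f := by
  have h := integral_comp_rotation g⁻¹ fun x => gaussIntegrand S p f x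
  rw [gaussFunctional, gaussFunctional, ← h]
  simp only [gaussIntegrand, polyNegLaplacian_rotate, rotate_apply,
    hψ.inner_matAct_sigmaBar hS (hinv g)]
  rfl

theorem gaussFunctional_translate (a : Vec d) (f : TestFn d L) :
    gaussFunctional S p (translate a f) = gaussFunctional S p f := by
  have h := integral_sub_right_eq_self (μ := volume) (fun x => gaussIntegrand S p f x) a
  rw [gaussFunctional, gaussFunctional, ← h]
  simp only [gaussIntegrand, polyNegLaplacian_translate, translate_apply]

theorem integral_gaussIntegrand_smul (t : ℝ) (f : TestFn d L) :
    ∫ x, gaussIntegrand S p (t • f) x = t ^ 2 * ∫ x, gaussIntegrand S p f x := by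
  rw [← integral_const_mul]
  congr 1 with x
  simp only [gaussIntegrand, map_smul, smul_apply, inner_smul_left, inner_smul_right,
    conj_trivial]
  ring

theorem gaussFunctional_add {f h : TestFn d L} (hfh : Disjoint (tsupport f) (tsupport h))
    (s t : ℝ) : gaussFunctional S p (s • f + t • h) =
      gaussFunctional S p (s • f) * gaussFunctional S p (t • h) := by
  rw [gaussFunctional, gaussFunctional, gaussFunctional, ← Complex.exp_add, ← neg_add,
    ← Complex.ofReal_add,
    ← integral_add (integrable_gaussIntegrand _) (integrable_gaussIntegrand _)]
  congr 4 with x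
  by_cases hx : x ∈ tsupport f
  · have hx := Set.disjoint_left.mp hfh hx
    simp [gaussIntegrand, image_eq_zero_of_notMem_tsupport hx,
      polyNegLaplacian_apply_eq_zero p h hx]
  · simp [gaussIntegrand, image_eq_zero_of_notMem_tsupport hx,
      polyNegLaplacian_apply_eq_zero p f hx]

/-- A random vector field is a `τ`-covariant noise field as soon as its characteristic functional
is invariant under rotations and translations, and multiplicative on functions with disjoint
supports. -/
theorem IsRandomVectorField.isNoiseField {Ω : Type*} [MeasurableSpace Ω] {P : Measure Ω}
    [IsProbabilityMeasure P] {φ : TestFn d L → Ω → ℝ} (hφ : IsRandomVectorField φ P)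
    {C : TestFn d L → ℂ} (hC : HasCharFunctional φ P C)
    (hrot : ∀ g f, C (rotate τ g f) = C f) (htrans : ∀ a f, C (translate a f) = C f)
    (hadd : ∀ f h : TestFn d L, Disjoint (tsupport f) (tsupport h) →
      ∀ s t : ℝ, C (s • f + t • h) = C (s • f) * C (t • h)) : IsNoiseField τ φ P where
  toIsRandomVectorField := hφ
  covariant g f := hC.identDistrib hφ fun t => by rw [← rotate_smul, hrot]
  stationary a f := hC.identDistrib hφ fun t => by rw [← translate_smul, htrans]
  indep f h hfh := hC.indepFun hφ (hadd f h hfh)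

end Symmetries

end NoiseField

theorem proposition2p1 {d L : ℕ} (τ : NoiseField.SO d →* GL (Fin L) ℝ)
    (ψ : NoiseField.Vec L → ℂ) (hψ : NoiseField.IsSmoothLevyCharacteristic ψ)
    (hinv : NoiseField.IsInvariant τ ψ) :
    -- part (i)
    ((∀ f : NoiseField.TestFn d L, MeasureTheory.Integrable (fun x => ψ (f x))) ∧
      NoiseField.IsCharFunctional (NoiseField.levyFunctional (d := d) ψ) ∧
      (∃ (Ω : Type) (_ : MeasurableSpace Ω) (P : MeasureTheory.Measure Ω)
        (_ : MeasureTheory.IsProbabilityMeasure P) (F : NoiseField.TestFn d L → Ω → ℝ),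
        NoiseField.IsRandomVectorField F P ∧
        NoiseField.HasCharFunctional F P (NoiseField.levyFunctional ψ)) ∧
      (∀ (Ω : Type*) [MeasurableSpace Ω] (P : MeasureTheory.Measure Ω)
        [MeasureTheory.IsProbabilityMeasure P] (F : NoiseField.TestFn d L → Ω → ℝ),
        NoiseField.IsRandomVectorField F P →
        NoiseField.HasCharFunctional F P (NoiseField.levyFunctional ψ) →
        NoiseField.IsNoiseField τ F P)) ∧
    -- part (ii)
    ((∃! S : Matrix (Fin L) (Fin L) ℝ, NoiseField.IsSigmaBar ψ S) ∧
      ∀ S : Matrix (Fin L) (Fin L) ℝ, NoiseField.IsSigmaBar ψ S →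
      ∀ p : Polynomial ℝ, (∀ t : ℝ, 0 ≤ t → 0 ≤ p.eval t) →
        (∀ f : NoiseField.TestFn d L,
          MeasureTheory.Integrable (NoiseField.gaussIntegrand S p f)) ∧
        NoiseField.IsCharFunctional (NoiseField.gaussFunctional (d := d) S p) ∧
        (∃ (Ω : Type) (_ : MeasurableSpace Ω) (P : MeasureTheory.Measure Ω)
          (_ : MeasureTheory.IsProbabilityMeasure P) (F : NoiseField.TestFn d L → Ω → ℝ),
          NoiseField.IsRandomVectorField F P ∧
          NoiseField.HasCharFunctional F P (NoiseField.gaussFunctional S p)) ∧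
        (∀ (Ω : Type*) [MeasurableSpace Ω] (P : MeasureTheory.Measure Ω)
          [MeasureTheory.IsProbabilityMeasure P] (F : NoiseField.TestFn d L → Ω → ℝ),
          NoiseField.IsRandomVectorField F P →
          NoiseField.HasCharFunctional F P (NoiseField.gaussFunctional S p) →
          NoiseField.IsNoiseField τ F P ∧ ProbabilityTheory.IsGaussianProcess F P)) := by
  have hexp := hψ.isLevyExponent
  have hchar := hexp.isCharFunctional (d := d)
  refine ⟨⟨hexp.integrable_comp, hchar, hchar.exists_randomVectorField, ?_⟩,
    hψ.existsUnique_sigmaBar, fun S hS p hp => ?_⟩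
  · intro Ω _ P _ F hF hC
    exact hF.isNoiseField hC (NoiseField.levyFunctional_rotate hinv)
      NoiseField.levyFunctional_translate fun f h hfh => hexp.levyFunctional_add hfh
  · have hgauss := NoiseField.isCharFunctional_gaussFunctional (d := d) (S := S) hp
    refine ⟨NoiseField.integrable_gaussIntegrand, hgauss, hgauss.exists_randomVectorField, ?_⟩
    intro Ω _ P _ F hF hC
    exact ⟨hF.isNoiseField hC (NoiseField.gaussFunctional_rotate hψ hinv hS)
        NoiseField.gaussFunctional_translate fun f h hfh => NoiseField.gaussFunctional_add hfh,
      hC.isGaussianProcess hF (fun f => rfl) (NoiseField.integral_gaussIntegrand_nonneg hp)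
        NoiseField.integral_gaussIntegrand_smul⟩
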